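/- **Setting.** Let $L,T,\nu>0$ and $D=[0,L]^2$ with periodic boundary conditions. Let $\mathbb L^2$, $\mathbb W^{k,2}$ be the spaces of periodic vector fields $D\to\mathbb R^2$ with mean zero that belong to $L^2$, resp. have weak derivatives up to order $k$ in $L^2$; write $|\cdot|_{\mathbb L^2}$ and $(\cdot,\cdot)$ for the $L^2$ norm and inner product, and $\|u\|_{\mathbb W^{1,2}}^2=|u|_{\mathbb L^2}^2+|\nabla u|_{\mathbb L^2}^2$. Let $H=\{u\in\mathbb L^2:\operatorname{div}u=0\text{ weakly}\}$, $V=H\cap\mathbb W^{1,2}$ with the norm $\|\cdot\|_V$ inherited from $\mathbb W^{1,2}$, $A=-\Delta$ with $\operatorname{Dom}(A)=\mathbb W^{2,2}\cap H$, and $b(u_1,u_2,u_3)=\int_D((u_1\cdot\nabla)u_2)\cdot u_3\,dx$. Let $\tilde C$ be a constant such that $|\nabla u|_{\mathbb L^2}^2\le\tilde C|Au|_{\mathbb L^2}^2$ for all $u\in\operatorname{Dom}(A)$. Let $K$ be a separable real Hilbert space, $Q$ a symmetric positive trace-class operator on $K$, and $W$ a $K$-valued Wiener process on $[0,T]$ with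 covariance operator $Q$ on a filtered probability space $(\Omega,\mathcal F,(\mathcal F_t),\mathbb P)$. Let $K_0,L_1>0$ and let $G:\mathbb L^2\to\mathcal L(K,\mathbb W^{1,2})$, with values in the bounded linear operators, satisfy $$\|G(u)\|_{\mathcal L(K,\mathbb L^2)}^2\le K_0\ \ (u\in\mathbb L^2),\qquad \|G(u)\|_{\mathcal L(K,\mathbb W^{1,2})}^2\le K_0\ \ (u\in\mathbb W^{1,2}),\qquad \|G(u)-G(v)\|_{\mathcal L(K,\mathbb L^2)}^2\le L_1|u-v|_{\mathbb L^2}^2\ \ (u,v\in\mathbb L^2).$$ Let $u_0\in V$ be deterministic. For $N\ge1$ put $t_l=lT/N$ and $\Delta_lW=W(t_l)-W(t_{l-1})$. A solution of the fully implicit time Euler scheme is a family $(\mathbf u^l)_{0\le l\le N}$ of $V$-valued random variables with $\mathbf u^l$ being $\mathcal F_{t_l}$-measurable, $\mathbf u^0=u_0$ a.s., and such that for $l=1,\dots,N$, a.s. for all $\phi\in V$, $$(\mathbf u^l-\mathbf u^{l-1},\phi)+\tfrac TN\big[\nu(\nabla\mathbf u^l,\nabla\phi)+b(\mathbf u^l,\mathbf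 u^l,\phi)\big]=(G(\mathbf u^{l-1})\Delta_lW,\phi).$$ **Theorem 8.1.** Set $\tilde\alpha_0=\dfrac{\nu}{2\tilde CK_0\operatorname{Tr}Q}$ (with $\tilde\alpha_0=+\infty$ if $Q=0$). For every $0<\alpha<\tilde\alpha_0$ there are a constant $C(\alpha)\in(0,\infty)$ and an integer $N_0$, such that for every $N\ge N_0$ and every solution $(\mathbf u^l)_{0\le l\le N}$ of the scheme with $N$ steps, the random variable $\exp(\alpha\max_{0\le l\le N}\|\mathbf u^l\|_V^2)$ is integrable and $$\mathbb E\Big[\exp\Big(\alpha\max_{0\le l\le N}\|\mathbf u^l\|_V^2\Big)\Big]\le C(\alpha).$$ -/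

import Mathlib

open MeasureTheory ProbabilityTheory
open scoped NNReal ENNReal

noncomputable section

namespace StochNS

/-! ### Function spaces of periodic vector fields on the square `[0, L]²` -/

/-- The square `D = [0, L]²`, one period cell of the torus. -/
def Dom (L : ℝ) : Set (Fin 2 → ℝ) := Set.Icc 0 (fun _ => L)

/-- Scalar `L²(D)`; a periodic `L²` function is determined by its restriction to the cell `D`. -/
abbrev Lsq (L : ℝ) : Type := Lp ℝ 2 (volume.restrict (Dom L))

/-- Smooth functions on `ℝ²` which are `L`-periodic in both coordinates. -/
def IsPeriodicTest (L : ℝ) (φ : (Fin 2 → ℝ) → ℝ) : Prop :=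
  ContDiff ℝ ((⊤ : ℕ∞) : WithTop ℕ∞) φ ∧ ∀ (i : Fin 2) (x : Fin 2 → ℝ), φ (x + Pi.single i L) = φ x

/-- The classical partial derivative in the direction `j`. -/
def pderiv (j : Fin 2) (φ : (Fin 2 → ℝ) → ℝ) (x : Fin 2 → ℝ) : ℝ :=
  fderiv ℝ φ x (Pi.single j 1)

/-- `g` is the weak partial derivative `∂ⱼ f` on the torus (tested against periodic functions). -/
def HasWeakPartial (L : ℝ) (f g : Lsq L) (j : Fin 2) : Prop :=
  ∀ φ : (Fin 2 → ℝ) → ℝ, IsPeriodicTest L φ →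
    ∫ x in Dom L, f x * pderiv j φ x = - ∫ x in Dom L, g x * φ x

lemma isCompact_Dom (L : ℝ) : IsCompact (Dom L) := isCompact_Icc

instance (L : ℝ) : IsFiniteMeasure (volume.restrict (Dom L)) :=
  ⟨by simpa using (isCompact_Dom L).measure_lt_top⟩

lemma integrable_mul_of_continuous {L : ℝ} (f : Lsq L) {ψ : (Fin 2 → ℝ) → ℝ}
    (hψ : Continuous ψ) : Integrable (fun x => f x * ψ x) (volume.restrict (Dom L)) := by
  obtain ⟨C, hC⟩ := (isCompact_Dom L).exists_bound_of_continuousOn hψ.continuousOn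
  refine ((Lp.memLp f).integrable (by norm_num)).mul_bdd (c := C) hψ.aestronglyMeasurable ?_
  exact (ae_restrict_iff' (isCompact_Dom L).measurableSet).2 (.of_forall hC)

lemma IsPeriodicTest.continuous {L : ℝ} {φ : (Fin 2 → ℝ) → ℝ} (h : IsPeriodicTest L φ) :
    Continuous φ := h.1.continuous

lemma IsPeriodicTest.continuous_pderiv {L : ℝ} {φ : (Fin 2 → ℝ) → ℝ} (h : IsPeriodicTest L φ)
    (j : Fin 2) : Continuous (pderiv j φ) :=
  (h.1.continuous_fderiv (by simp)).clm_apply continuous_const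

lemma integral_add_mul {L : ℝ} (f g : Lsq L) {ψ : (Fin 2 → ℝ) → ℝ} (hψ : Continuous ψ) :
    ∫ x in Dom L, (f + g) x * ψ x
      = (∫ x in Dom L, f x * ψ x) + ∫ x in Dom L, g x * ψ x := by
  rw [← integral_add (integrable_mul_of_continuous f hψ) (integrable_mul_of_continuous g hψ)]
  refine integral_congr_ae ?_
  filter_upwards [Lp.coeFn_add f g] with x hx
  rw [hx, Pi.add_apply, add_mul]

lemma integral_smul_mul {L : ℝ} (c : ℝ) (f : Lsq L) (ψ : (Fin 2 → ℝ) → ℝ) :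
    ∫ x in Dom L, (c • f) x * ψ x = c * ∫ x in Dom L, f x * ψ x := by
  rw [← integral_const_mul]
  refine integral_congr_ae ?_
  filter_upwards [Lp.coeFn_smul c f] with x hx
  rw [hx, Pi.smul_apply, smul_eq_mul, mul_assoc]

lemma integral_zero_mul {L : ℝ} (ψ : (Fin 2 → ℝ) → ℝ) :
    ∫ x in Dom L, (0 : Lsq L) x * ψ x = 0 := by
  simpa using integral_smul_mul (0 : ℝ) (0 : Lsq L) ψ

lemma HasWeakPartial.zero (L : ℝ) (j : Fin 2) : HasWeakPartial L 0 0 j := by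
  intro φ _
  rw [integral_zero_mul, integral_zero_mul, neg_zero]

lemma HasWeakPartial.add {L : ℝ} {f g f' g' : Lsq L} {j : Fin 2}
    (h : HasWeakPartial L f g j) (h' : HasWeakPartial L f' g' j) :
    HasWeakPartial L (f + f') (g + g') j := by
  intro φ hφ
  rw [integral_add_mul f f' (hφ.continuous_pderiv j), integral_add_mul g g' hφ.continuous,
    h φ hφ, h' φ hφ]
  ring

lemma HasWeakPartial.smul {L : ℝ} {f g : Lsq L} {j : Fin 2} (c : ℝ)
    (h : HasWeakPartial L f g j) : HasWeakPartial L (c • f) (c • g) j := by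
  intro φ hφ
  rw [integral_smul_mul, integral_smul_mul, h φ hφ]
  ring

/-- The mean-zero fields in `[L²(D)]²`. -/
def meanZero (L : ℝ) : Submodule ℝ (PiLp 2 fun _ : Fin 2 => Lsq L) where
  carrier := {u | ∀ i, ∫ x in Dom L, u i x * 1 = 0}
  zero_mem' := fun i => integral_zero_mul _
  add_mem' := by
    intro u v hu hv i
    simp only [Set.mem_ofPred_eq] at hu hv
    rw [PiLp.add_apply, integral_add_mul _ _ continuous_const, hu i, hv i, add_zero]
  smul_mem' := by
    intro c u hu i
    simp only [Set.mem_ofPred_eq] at hu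
    rw [PiLp.smul_apply, integral_smul_mul, hu i, mul_zero]

/-- `𝕃²`: periodic vector fields in `[L²(D)]²` with mean zero, with its Hilbert norm `|·|_{𝕃²}`. -/
def L2v (L : ℝ) : Type := meanZero L

instance (L : ℝ) : NormedAddCommGroup (L2v L) :=
  inferInstanceAs (NormedAddCommGroup (meanZero L))

instance (L : ℝ) : InnerProductSpace ℝ (L2v L) :=
  inferInstanceAs (InnerProductSpace ℝ (meanZero L))

/-- The `i`-th component of a vector field in `𝕃²`. -/
def comp {L : ℝ} (u : L2v L) (i : Fin 2) : Lsq L :=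
  ((show meanZero L from u) : PiLp 2 fun _ : Fin 2 => Lsq L) i

/-- `2 × 2` tensor fields in `L²(D)`, with the (Frobenius) `L²` norm. -/
def L2t (L : ℝ) : Type := PiLp 2 fun _ : Fin 2 × Fin 2 => Lsq L

instance (L : ℝ) : NormedAddCommGroup (L2t L) :=
  inferInstanceAs (NormedAddCommGroup (PiLp 2 fun _ : Fin 2 × Fin 2 => Lsq L))

instance (L : ℝ) : InnerProductSpace ℝ (L2t L) :=
  inferInstanceAs (InnerProductSpace ℝ (PiLp 2 fun _ : Fin 2 × Fin 2 => Lsq L))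

/-- The entry `(i, j)` of a tensor field. -/
def entry {L : ℝ} (g : L2t L) (i j : Fin 2) : Lsq L :=
  (show PiLp 2 fun _ : Fin 2 × Fin 2 => Lsq L from g) (i, j)

/-- The pairs `(u, ∇u)` with `u` in `𝕃²` and weak gradient `∇u` in `L²`, where the entry `(i, j)`
of `∇u` is `∂ⱼ uᵢ`. -/
def gradGraph (L : ℝ) : Submodule ℝ (WithLp 2 (L2v L × L2t L)) where
  carrier := {p | ∀ i j, HasWeakPartial L (comp p.fst i) (entry p.snd i j) j}
  zero_mem' := fun _ j => HasWeakPartial.zero L j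
  add_mem' := fun hp hq i j => (hp i j).add (hq i j)
  smul_mem' := fun c _ hp i j => (hp i j).smul c

/-- `𝕎^{1,2}`: mean-zero periodic vector fields with weak gradient in `L²`, realised as the set of
pairs `(u, ∇u)`. Its norm is `‖u‖² = |u|²_{𝕃²} + |∇u|²_{𝕃²}`. -/
def W12 (L : ℝ) : Type := gradGraph L

instance (L : ℝ) : NormedAddCommGroup (W12 L) :=
  inferInstanceAs (NormedAddCommGroup (gradGraph L))

instance (L : ℝ) : InnerProductSpace ℝ (W12 L) :=
  inferInstanceAs (InnerProductSpace ℝ (gradGraph L))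

/-- The continuous embedding `𝕎^{1,2} → 𝕃²`. -/
def toL2 (L : ℝ) : W12 L →L[ℝ] L2v L :=
  (WithLp.fstL 2 ℝ (L2v L) (L2t L)).comp (gradGraph L).subtypeL

/-- The weak gradient `∇ : 𝕎^{1,2} → [L²(D)]^{2×2}`. -/
def grad (L : ℝ) : W12 L →L[ℝ] L2t L :=
  (WithLp.sndL 2 ℝ (L2v L) (L2t L)).comp (gradGraph L).subtypeL

/-- `H`: the fields of `𝕃²` whose divergence vanishes weakly. -/
def H (L : ℝ) : Submodule ℝ (L2v L) where
  carrier := {u | ∀ φ : (Fin 2 → ℝ) → ℝ, IsPeriodicTest L φ →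
    ∑ i, ∫ x in Dom L, comp u i x * pderiv i φ x = 0}
  zero_mem' := fun φ _ => Finset.sum_eq_zero fun _ _ => integral_zero_mul _
  add_mem' := by
    intro u v hu hv φ hφ
    have h : ∀ i, ∫ x in Dom L, comp (u + v) i x * pderiv i φ x
        = (∫ x in Dom L, comp u i x * pderiv i φ x) + ∫ x in Dom L, comp v i x * pderiv i φ x :=
      fun i => integral_add_mul (comp u i) (comp v i) (hφ.continuous_pderiv i)
    rw [Finset.sum_congr rfl fun i _ => h i, Finset.sum_add_distrib, hu φ hφ, hv φ hφ, add_zero]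
  smul_mem' := by
    intro c u hu φ hφ
    have h : ∀ i, ∫ x in Dom L, comp (c • u) i x * pderiv i φ x
        = c * ∫ x in Dom L, comp u i x * pderiv i φ x :=
      fun i => integral_smul_mul c (comp u i) _
    rw [Finset.sum_congr rfl fun i _ => h i, ← Finset.mul_sum, hu φ hφ, mul_zero]

/-- `V = H ∩ 𝕎^{1,2}`, with the norm inherited from `𝕎^{1,2}`. -/
def V (L : ℝ) : Submodule ℝ (W12 L) := (H L).comap (toL2 L : W12 L →ₗ[ℝ] L2v L)

/-- An element of `Dom(A) = 𝕎^{2,2} ∩ H`: a field `u ∈ V` together with its second weak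
derivatives `hess i j k = ∂ₖ ∂ⱼ uᵢ`, all in `L²(D)`. -/
structure DomA (L : ℝ) where
  u : V L
  hess : Fin 2 → Fin 2 → Fin 2 → Lsq L
  hasWeakPartial : ∀ i j k, HasWeakPartial L (entry (grad L u) i j) (hess i j k) k

/-- `A u = -Δ u`. -/
def DomA.A {L : ℝ} (w : DomA L) : PiLp 2 fun _ : Fin 2 => Lsq L :=
  WithLp.toLp 2 fun i => -∑ j, w.hess i j j

/-- `b(u₁, u₂, u₃) = ∫_D ((u₁ · ∇) u₂) · u₃`. -/
def trilin {L : ℝ} (u₁ u₂ u₃ : W12 L) : ℝ :=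
  ∫ x in Dom L, ∑ i, ∑ j,
    comp (toL2 L u₁) j x * entry (grad L u₂) i j x * comp (toL2 L u₃) i x

/-! ### The noise -/

section noise

variable {Ω : Type*} {mΩ : MeasurableSpace Ω} {K : Type*} [NormedAddCommGroup K]
  [InnerProductSpace ℝ K]

/-- The trace of a positive operator, computed in the orthonormal basis `e`. -/
def trace {ι : Type*} (e : HilbertBasis ι ℝ K) (Q : K →L[ℝ] K) : ℝ := ∑' j, inner ℝ (Q (e j)) (e j)

/-- `W` is, on the time interval `[0, T]`, a `K`-valued Wiener process with covariance operator `Q`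
with respect to the filtration `ℱ`: it starts at `0`, is adapted, has a.s. continuous paths, and
`W t - W s` is independent of `ℱ s` and centred Gaussian with covariance `(t - s) Q`. -/
structure IsWiener [MeasurableSpace K] (P : Measure Ω) (ℱ : Filtration ℝ≥0 mΩ) (T : ℝ≥0)
    (Q : K →L[ℝ] K) (W : ℝ≥0 → Ω → K) : Prop where
  zero : ∀ᵐ ω ∂P, W 0 ω = 0
  adapted : ∀ t ≤ T, StronglyMeasurable[ℱ t] (W t)
  continuous : ∀ᵐ ω ∂P, ContinuousOn (fun t => W t ω) (Set.Icc 0 T)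
  indep : ∀ s t, s ≤ t → t ≤ T →
    Indep (MeasurableSpace.comap (fun ω => W t ω - W s ω) inferInstance) (ℱ s) P
  gaussian : ∀ s t, s ≤ t → t ≤ T → ∀ h : K,
    P.map (fun ω => inner ℝ (W t ω - W s ω) h)
      = gaussianReal 0 (((t : ℝ) - s) * inner ℝ (Q h) h).toNNReal

/-- The growth and Lipschitz condition on `G : 𝕃² → 𝓛(K, 𝕎^{1,2})`, with constants
`K₀`, `K₁`, `L₁`. -/
structure ConditionG1 {L : ℝ} (G : L2v L → K →L[ℝ] W12 L) (K₀ K₁ L₁ : ℝ) : Prop where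
  growth_L2 : ∀ u : L2v L, ‖(toL2 L).comp (G u)‖ ^ 2 ≤ K₀ + K₁ * ‖u‖ ^ 2
  growth_W12 : ∀ u : W12 L, ‖G (toL2 L u)‖ ^ 2 ≤ K₀ + K₁ * ‖u‖ ^ 2
  lipschitz : ∀ u v : L2v L, ‖(toL2 L).comp (G u - G v)‖ ^ 2 ≤ L₁ * ‖u - v‖ ^ 2

/-! ### The fully implicit time Euler scheme -/

/-- The grid point `t_l = l T / N`. -/
def grid (T : ℝ≥0) (N l : ℕ) : ℝ≥0 := l * T / N

/-- `u 0, …, u N` is a solution of the fully implicit time Euler scheme with `N` steps on `[0, T]`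
started at `u₀`: the `V`-valued random variable `u l` is `ℱ (t_l)`-measurable, and a.s., for all
`φ ∈ V`,
`(u^{l+1} - u^l, φ) + (T/N) [ν (∇u^{l+1}, ∇φ) + b(u^{l+1}, u^{l+1}, φ)] = (G(u^l) Δ_{l+1} W, φ)`. -/
structure IsEulerScheme {L : ℝ} (P : Measure Ω) (ℱ : Filtration ℝ≥0 mΩ) (T : ℝ≥0) (ν : ℝ)
    (W : ℝ≥0 → Ω → K) (G : L2v L → K →L[ℝ] W12 L) (u₀ : V L) (N : ℕ) (u : ℕ → Ω → V L) :
    Prop where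
  init : ∀ᵐ ω ∂P, u 0 ω = u₀
  adapted : ∀ l ≤ N, StronglyMeasurable[ℱ (grid T N l)] (u l)
  step : ∀ l < N, ∀ᵐ ω ∂P, ∀ φ : V L,
    inner ℝ (toL2 L (u (l + 1) ω) - toL2 L (u l ω)) (toL2 L φ)
      + (T : ℝ) / N * (ν * inner ℝ (grad L (u (l + 1) ω)) (grad L φ)
          + trilin (u (l + 1) ω : W12 L) (u (l + 1) ω) φ)
      = inner ℝ (toL2 L (G (toL2 L (u l ω)) (W (grid T N (l + 1)) ω - W (grid T N l) ω)))
          (toL2 L φ)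

end noise

end StochNS

end

noncomputable section

namespace StochNS

/-- The phase `2π/L k·x`. -/
def phase (L : ℝ) (k : Fin 2 → ℤ) (x : Fin 2 → ℝ) : ℝ := 2 * Real.pi / L * ∑ i, (k i : ℝ) * x i

/-- The `L`-periodic exponential with frequency `k`. -/
def expo (L : ℝ) (k : Fin 2 → ℤ) (x : Fin 2 → ℝ) : ℂ := Complex.exp (phase L k x * Complex.I)

lemma continuous_phase (L : ℝ) (k : Fin 2 → ℤ) : Continuous (phase L k) := by
  unfold phase; fun_prop

lemma continuous_expo (L : ℝ) (k : Fin 2 → ℤ) : Continuous (expo L k) := by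
  have := continuous_phase L k
  unfold expo; fun_prop

lemma norm_expo (L : ℝ) (k : Fin 2 → ℤ) (x : Fin 2 → ℝ) : ‖expo L k x‖ = 1 :=
  Complex.norm_exp_ofReal_mul_I _

lemma phase_add (L : ℝ) (k m : Fin 2 → ℤ) (x : Fin 2 → ℝ) :
    phase L (k + m) x = phase L k x + phase L m x := by
  simp [phase, Fin.sum_univ_two]; ring

lemma phase_neg (L : ℝ) (k : Fin 2 → ℤ) (x : Fin 2 → ℝ) : phase L (-k) x = -phase L k x := by
  simp [phase, Fin.sum_univ_two]; ring

lemma expo_add (L : ℝ) (k m : Fin 2 → ℤ) (x : Fin 2 → ℝ) :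
    expo L (k + m) x = expo L k x * expo L m x := by
  simp only [expo, phase_add, ← Complex.exp_add]; congr 1; push_cast; ring

lemma expo_neg (L : ℝ) (k : Fin 2 → ℤ) (x : Fin 2 → ℝ) :
    expo L (-k) x = (starRingEnd ℂ) (expo L k x) := by
  simp only [expo, phase_neg, ← Complex.exp_conj]; congr 1
  simp

/-- The Fourier coefficient of a function on the square. -/
def fcoeff (L : ℝ) (f : (Fin 2 → ℝ) → ℂ) (k : Fin 2 → ℤ) : ℂ :=
  ((L ^ 2)⁻¹ : ℝ) * ∫ x in Dom L, f x * expo L (-k) x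

/-- The section `ℝ²/ℤ² → [0, L]²` of the covering map. -/
def torusSection (L : ℝ) (y : UnitAddTorus (Fin 2)) : Fin 2 → ℝ :=
  fun i => L * (AddCircle.equivIoc 1 0 (y i) : ℝ)

/-- The Haar probability measure on the torus. -/
abbrev torusHaar : Measure (UnitAddTorus (Fin 2)) :=
  Measure.pi fun _ => (AddCircle.haarAddCircle : Measure UnitAddCircle)

lemma measurePreserving_torusSection {L : ℝ} (hL : 0 < L) :
    MeasurePreserving (torusSection L) torusHaar
      ((ENNReal.ofReal (L ^ 2))⁻¹ • volume.restrict (Dom L)) := by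
  have h1 : MeasurePreserving (UnitAddTorus.measurableEquivPiIoc (0 : Fin 2 → ℝ)) torusHaar
      (Measure.comap Subtype.val volume) := UnitAddTorus.measurePreserving_equivPiIoc 0
  set B : Set (Fin 2 → ℝ) := {x | ∀ i, x i ∈ Set.Ioc ((0 : Fin 2 → ℝ) i) ((0 : Fin 2 → ℝ) i + 1)}
  have hB : MeasurableSet B := MeasurableSet.univ_pi' (fun i => measurableSet_Ioc)
  have h2 : MeasurePreserving (Subtype.val : B → (Fin 2 → ℝ)) (Measure.comap Subtype.val volume)
      (volume.restrict B) := ⟨measurable_subtype_coe, map_comap_subtype_coe hB _⟩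
  have h3 : MeasurePreserving (fun x : Fin 2 → ℝ => L • x) (volume.restrict B)
      ((ENNReal.ofReal (L ^ 2))⁻¹ • volume.restrict (Dom L)) := by
    refine ⟨by fun_prop, ?_⟩
    have hD : volume.restrict (Dom L)
        = volume.restrict (Set.pi Set.univ fun i : Fin 2 => Set.Ioc (0 : ℝ) L) := by
      refine (Measure.restrict_congr_set ?_).symm
      exact Measure.univ_pi_Ioc_ae_eq_Icc (f := (0 : Fin 2 → ℝ)) (g := fun _ => L)
    have hpre : B = (fun x : Fin 2 → ℝ => L • x) ⁻¹'
        (Set.pi Set.univ fun i : Fin 2 => Set.Ioc (0 : ℝ) L) := by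
      ext x
      simp [B, hL, mul_le_iff_le_one_right]
    rw [hD, hpre, ← Measure.restrict_map (by fun_prop)
      (MeasurableSet.univ_pi fun i => measurableSet_Ioc), Measure.map_addHaar_smul _ hL.ne',
      Measure.restrict_smul]
    congr 1
    rw [abs_of_pos (by positivity), ENNReal.ofReal_inv_of_pos (by positivity)]
    simp
  exact h3.comp (h2.comp h1)

lemma mFourier_eq_expo {L : ℝ} (hL : 0 < L) (k : Fin 2 → ℤ) (y : UnitAddTorus (Fin 2)) :
    UnitAddTorus.mFourier k y = expo L k (torusSection L y) := by
  have h : ∀ i, fourier (k i) (y i)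
      = Complex.exp (2 * Real.pi * Complex.I * k i * (AddCircle.equivIoc 1 0 (y i) : ℝ)) := by
    intro i
    conv_lhs => rw [← AddCircle.coe_equivIoc (p := (1 : ℝ)) (a := 0) (y := y i)]
    rw [fourier_coe_apply]
    simp
  simp only [UnitAddTorus.mFourier, ContinuousMap.coe_mk, h, Fin.prod_univ_two, expo, phase,
    torusSection, Fin.sum_univ_two, ← Complex.exp_add]
  congr 1
  have : (L : ℂ) ≠ 0 := by exact_mod_cast hL.ne'
  push_cast
  field_simp

lemma integral_torusSection {L : ℝ} (hL : 0 < L) (f : (Fin 2 → ℝ) → ℂ)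
    (hf : AEStronglyMeasurable f (volume.restrict (Dom L))) :
    ∫ y, f (torusSection L y) ∂torusHaar = ((L ^ 2)⁻¹ : ℝ) * ∫ x in Dom L, f x := by
  have h := measurePreserving_torusSection hL
  have hc : (ENNReal.ofReal (L ^ 2))⁻¹ ≠ ∞ := by simp [hL.ne']
  rw [← integral_map h.aemeasurable (by rw [h.map_eq]; exact hf.mono_ac Measure.smul_absolutelyContinuous), h.map_eq, integral_smul_measure]
  simp [Complex.real_smul, ENNReal.toReal_ofReal (sq_nonneg L)]

/-- **Parseval's identity** on the square. -/
theorem hasSum_fcoeff {L : ℝ} (hL : 0 < L) {f g : (Fin 2 → ℝ) → ℂ}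
    (hf : MemLp f 2 (volume.restrict (Dom L))) (hg : MemLp g 2 (volume.restrict (Dom L))) :
    HasSum (fun k => (starRingEnd ℂ) (fcoeff L f k) * fcoeff L g k)
      (((L ^ 2)⁻¹ : ℝ) * ∫ x in Dom L, (starRingEnd ℂ) (f x) * g x) := by
  have h := measurePreserving_torusSection hL
  have hc : (ENNReal.ofReal (L ^ 2))⁻¹ ≠ ∞ := by simp [hL.ne']
  have lift : ∀ {F : (Fin 2 → ℝ) → ℂ}, MemLp F 2 (volume.restrict (Dom L)) →
      MemLp (fun y => F (torusSection L y)) 2 torusHaar := fun hF =>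
    (hF.smul_measure hc).comp_measurePreserving h
  have coeff : ∀ {F : (Fin 2 → ℝ) → ℂ} (hF : MemLp F 2 (volume.restrict (Dom L))) (k),
      UnitAddTorus.mFourierCoeff (lift hF).toLp k = fcoeff L F k := by
    intro F hF k
    rw [fcoeff, ← integral_torusSection hL (fun x => F x * expo L (-k) x)
      (hF.1.mul (continuous_expo L _).aestronglyMeasurable)]
    refine integral_congr_ae ?_
    filter_upwards [(lift hF).coeFn_toLp] with y hy
    rw [hy, mFourier_eq_expo hL, smul_eq_mul, mul_comm]
  have key := UnitAddTorus.hasSum_prod_mFourierCoeff (lift hf).toLp (lift hg).toLp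
  simp only [coeff hf, coeff hg] at key
  convert key using 1
  rw [← integral_torusSection hL (fun x => (starRingEnd ℂ) (f x) * g x)
    ((Complex.continuous_conj.comp_aestronglyMeasurable hf.1).mul hg.1)]
  refine integral_congr_ae ?_
  filter_upwards [(lift hf).coeFn_toLp, (lift hg).coeFn_toLp] with y hy hy'
  rw [hy, hy']

/-- The Fourier coefficient of a real `L²` function. -/
def rcoeff {L : ℝ} (f : Lsq L) (k : Fin 2 → ℤ) : ℂ := fcoeff L (fun x => (f x : ℂ)) k

lemma memLp_ofReal {L : ℝ} (f : Lsq L) :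
    MemLp (fun x => (f x : ℂ)) 2 (volume.restrict (Dom L)) := (Lp.memLp f).ofReal

lemma rcoeff_neg {L : ℝ} (f : Lsq L) (k : Fin 2 → ℤ) :
    rcoeff f (-k) = (starRingEnd ℂ) (rcoeff f k) := by
  simp only [rcoeff, fcoeff, map_mul, Complex.conj_ofReal, ← integral_conj, expo_neg,
    Complex.conj_conj, neg_neg]

theorem hasSum_rcoeff {L : ℝ} (hL : 0 < L) (f g : Lsq L) :
    HasSum (fun k => (starRingEnd ℂ) (rcoeff f k) * rcoeff g k)
      ((((L ^ 2)⁻¹ * inner ℝ f g : ℝ)) : ℂ) := by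
  convert hasSum_fcoeff hL (memLp_ofReal f) (memLp_ofReal g) using 1
  · rfl
  · rw [L2.inner_def, Complex.ofReal_mul, ← integral_complex_ofReal]
    simp [mul_comm]

/-- The coefficients of a product are given by convolution. -/
theorem hasSum_convolution {L : ℝ} (hL : 0 < L) (f g : Lsq L) (k : Fin 2 → ℤ) :
    HasSum (fun p => rcoeff f (k - p) * rcoeff g p)
      (fcoeff L (fun x => (f x * g x : ℝ)) k) := by
  have hF : MemLp (fun x => (f x : ℂ) * expo L k x) 2 (volume.restrict (Dom L)) := by
    refine (memLp_ofReal f).of_le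
      ((memLp_ofReal f).1.mul (continuous_expo L k).aestronglyMeasurable) (.of_forall fun x => ?_)
    simp [norm_expo]
  convert hasSum_fcoeff hL hF (memLp_ofReal g) using 1
  · ext p
    congr 1
    rw [← neg_sub, rcoeff_neg]
    simp only [rcoeff, fcoeff, neg_sub]
    congr 3
    ext x
    rw [mul_assoc, ← expo_add]
    congr 2
  · rw [fcoeff]
    congr 2
    ext x
    rw [expo_neg]
    push_cast
    simp
    ring

/-! ### Periodic test functions -/

lemma IsPeriodicTest.differentiable {L : ℝ} {φ : (Fin 2 → ℝ) → ℝ} (h : IsPeriodicTest L φ) :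
    Differentiable ℝ φ := h.1.differentiable (by simp)

lemma IsPeriodicTest.mul {L : ℝ} {φ ψ : (Fin 2 → ℝ) → ℝ} (hφ : IsPeriodicTest L φ)
    (hψ : IsPeriodicTest L ψ) : IsPeriodicTest L (fun x => φ x * ψ x) :=
  ⟨hφ.1.mul hψ.1, fun i x => congrArg₂ _ (hφ.2 i x) (hψ.2 i x)⟩

lemma pderiv_mul {L : ℝ} {φ ψ : (Fin 2 → ℝ) → ℝ} (hφ : IsPeriodicTest L φ)
    (hψ : IsPeriodicTest L ψ) (j : Fin 2) (x : Fin 2 → ℝ) :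
    pderiv j (fun x => φ x * ψ x) x = φ x * pderiv j ψ x + pderiv j φ x * ψ x := by
  rw [pderiv, fderiv_fun_mul (hφ.differentiable x) (hψ.differentiable x)]
  simp [pderiv, mul_comm]

lemma integral_pderiv_eq_zero {L : ℝ} (hL : 0 < L) {φ : (Fin 2 → ℝ) → ℝ}
    (hφ : IsPeriodicTest L φ) (j : Fin 2) : ∫ x in Dom L, pderiv j φ x = 0 := by
  have key := integral_divergence_of_hasFDerivAt_off_countable' (n := 1) (E := ℝ)
    (0 : Fin 2 → ℝ) (fun _ => L) (fun _ => hL.le)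
    (fun i => if i = j then φ else fun _ => 0)
    (fun i x => if i = j then fderiv ℝ φ x else 0) ∅ Set.countable_empty
    (fun i => by
      split_ifs
      · exact hφ.continuous.continuousOn
      · exact continuousOn_const)
    (fun x _ i => by
      split_ifs
      · exact (hφ.differentiable x).hasFDerivAt
      · exact hasFDerivAt_const _ _)
    (by
      refine Continuous.integrableOn_Icc (continuous_finsetSum _ fun i _ => ?_)
      split_ifs
      · exact (hφ.1.continuous_fderiv (by simp)).clm_apply continuous_const
      · exact continuous_const)
  have hl : ∀ x, ∑ i, (if i = j then fderiv ℝ φ x else 0) (Pi.single i 1) = pderiv j φ x := by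
    intro x
    rw [Finset.sum_eq_single j] <;> simp +contextual [pderiv]
  simp only [hl] at key
  rw [Dom, key, Finset.sum_eq_zero]
  intro i _
  split_ifs with h
  · subst h
    rw [sub_eq_zero]
    congr 1
    ext x
    rw [← hφ.2 i (i.insertNth ((0 : Fin 2 → ℝ) i) x)]
    congr 1
    ext l
    refine Fin.succAboveCases i ?_ (fun l => ?_) l
    · simp
    · simp
  · simp

/-- The class in `L²(D)` of a continuous function. -/
def ofCont (L : ℝ) (ψ : (Fin 2 → ℝ) → ℝ) (hψ : Continuous ψ) : Lsq L :=
  MemLp.toLp ψ (by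
    obtain ⟨C, hC⟩ := (isCompact_Dom L).exists_bound_of_continuousOn hψ.continuousOn
    exact MemLp.of_bound hψ.aestronglyMeasurable C
      ((ae_restrict_iff' (isCompact_Dom L).measurableSet).2 (.of_forall hC)))

lemma coeFn_ofCont (L : ℝ) {ψ : (Fin 2 → ℝ) → ℝ} (hψ : Continuous ψ) :
    ofCont L ψ hψ =ᵐ[volume.restrict (Dom L)] ψ := MemLp.coeFn_toLp _

lemma inner_ofCont {L : ℝ} (f : Lsq L) {ψ : (Fin 2 → ℝ) → ℝ} (hψ : Continuous ψ) :
    inner ℝ f (ofCont L ψ hψ) = ∫ x in Dom L, f x * ψ x := by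
  rw [L2.inner_def]
  refine integral_congr_ae ?_
  filter_upwards [coeFn_ofCont L hψ] with x hx
  simp [hx, mul_comm]

lemma integral_ofCont_mul (L : ℝ) {ψ : (Fin 2 → ℝ) → ℝ} (hψ : Continuous ψ)
    (φ : (Fin 2 → ℝ) → ℝ) :
    ∫ x in Dom L, ofCont L ψ hψ x * φ x = ∫ x in Dom L, ψ x * φ x := by
  refine integral_congr_ae ?_
  filter_upwards [coeFn_ofCont L hψ] with x hx
  rw [hx]

lemma integrable_Dom {L : ℝ} {ψ : (Fin 2 → ℝ) → ℝ} (hψ : Continuous ψ) :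
    Integrable ψ (volume.restrict (Dom L)) :=
  hψ.continuousOn.integrableOn_compact (isCompact_Dom L)

lemma integral_mul_pderiv {L : ℝ} (hL : 0 < L) {φ ψ : (Fin 2 → ℝ) → ℝ}
    (hφ : IsPeriodicTest L φ) (hψ : IsPeriodicTest L ψ) (j : Fin 2) :
    ∫ x in Dom L, ψ x * pderiv j φ x = - ∫ x in Dom L, pderiv j ψ x * φ x := by
  have h := integral_pderiv_eq_zero hL (hψ.mul hφ) j
  simp only [pderiv_mul hψ hφ] at h
  have i1 : Integrable (fun x => ψ x * pderiv j φ x) (volume.restrict (Dom L)) :=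
    integrable_Dom (hψ.continuous.mul (hφ.continuous_pderiv j))
  have i2 : Integrable (fun x => pderiv j ψ x * φ x) (volume.restrict (Dom L)) :=
    integrable_Dom ((hψ.continuous_pderiv j).mul hφ.continuous)
  rw [integral_add i1 i2] at h
  linarith

lemma hasWeakPartial_ofCont {L : ℝ} (hL : 0 < L) {ψ : (Fin 2 → ℝ) → ℝ}
    (hψ : IsPeriodicTest L ψ) (j : Fin 2) :
    HasWeakPartial L (ofCont L ψ hψ.continuous) (ofCont L (pderiv j ψ) (hψ.continuous_pderiv j))
      j := by
  intro φ hφ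
  rw [integral_ofCont_mul, integral_ofCont_mul, integral_mul_pderiv hL hφ hψ]

/-! ### Trigonometric functions -/

/-- `cos (2π/L k·x)`. -/
def cosMode (L : ℝ) (k : Fin 2 → ℤ) (x : Fin 2 → ℝ) : ℝ := Real.cos (phase L k x)

/-- `sin (2π/L k·x)`. -/
def sinMode (L : ℝ) (k : Fin 2 → ℤ) (x : Fin 2 → ℝ) : ℝ := Real.sin (phase L k x)

lemma contDiff_phase (L : ℝ) (k : Fin 2 → ℤ) {n : WithTop ℕ∞} : ContDiff ℝ n (phase L k) := by
  unfold phase; fun_prop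

lemma phase_add_single {L : ℝ} (hL : 0 < L) (k : Fin 2 → ℤ) (i : Fin 2) (x : Fin 2 → ℝ) :
    phase L k (x + Pi.single i L) = phase L k x + k i * (2 * Real.pi) := by
  have hL' := hL.ne'
  fin_cases i <;> simp [phase, Fin.sum_univ_two] <;> field_simp <;> ring

lemma isPeriodicTest_cosMode {L : ℝ} (hL : 0 < L) (k : Fin 2 → ℤ) :
    IsPeriodicTest L (cosMode L k) :=
  ⟨Real.contDiff_cos.comp (contDiff_phase L k), fun i x => by
    simp only [cosMode, phase_add_single hL, Real.cos_add_int_mul_two_pi]⟩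

lemma isPeriodicTest_sinMode {L : ℝ} (hL : 0 < L) (k : Fin 2 → ℤ) :
    IsPeriodicTest L (sinMode L k) :=
  ⟨Real.contDiff_sin.comp (contDiff_phase L k), fun i x => by
    simp only [sinMode, phase_add_single hL, Real.sin_add_int_mul_two_pi]⟩

lemma fderiv_phase (L : ℝ) (k : Fin 2 → ℤ) (j : Fin 2) (x : Fin 2 → ℝ) :
    fderiv ℝ (phase L k) x (Pi.single j 1) = 2 * Real.pi / L * k j := by
  have h : phase L k = (((2 * Real.pi / L) • ∑ i, (k i : ℝ) •
      (ContinuousLinearMap.proj i : (Fin 2 → ℝ) →L[ℝ] ℝ) : (Fin 2 → ℝ) →L[ℝ] ℝ)) := by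
    ext x; simp [phase, Fin.sum_univ_two, mul_add]
  rw [h, ContinuousLinearMap.fderiv]
  fin_cases j <;> simp [Fin.sum_univ_two]

lemma pderiv_cosMode (L : ℝ) (k : Fin 2 → ℤ) (j : Fin 2) :
    pderiv j (cosMode L k) = fun x => -(2 * Real.pi / L * k j) * sinMode L k x := by
  ext x
  have := ((contDiff_phase L k (n := 1)).differentiable (by simp) x).hasFDerivAt.cos
  rw [pderiv, show cosMode L k = fun x => Real.cos (phase L k x) from rfl, this.fderiv]
  simp [fderiv_phase, sinMode]; ring

lemma pderiv_sinMode (L : ℝ) (k : Fin 2 → ℤ) (j : Fin 2) :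
    pderiv j (sinMode L k) = fun x => (2 * Real.pi / L * k j) * cosMode L k x := by
  ext x
  have := ((contDiff_phase L k (n := 1)).differentiable (by simp) x).hasFDerivAt.sin
  rw [pderiv, show sinMode L k = fun x => Real.sin (phase L k x) from rfl, this.fderiv]
  simp [fderiv_phase, cosMode]; ring

lemma pderiv_const_mul {L : ℝ} (c : ℝ) {ψ : (Fin 2 → ℝ) → ℝ} (hψ : IsPeriodicTest L ψ)
    (j : Fin 2) : pderiv j (fun x => c * ψ x) = fun x => c * pderiv j ψ x := by
  ext x
  rw [pderiv, fderiv_const_mul (hψ.differentiable x)]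
  simp [pderiv]

lemma IsPeriodicTest.const_mul {L : ℝ} (c : ℝ) {ψ : (Fin 2 → ℝ) → ℝ} (hψ : IsPeriodicTest L ψ) :
    IsPeriodicTest L (fun x => c * ψ x) :=
  ⟨contDiff_const.mul hψ.1, fun i x => congrArg _ (hψ.2 i x)⟩

lemma fcoeff_ofReal {L : ℝ} {f : (Fin 2 → ℝ) → ℝ} (hf : Integrable f (volume.restrict (Dom L)))
    (k : Fin 2 → ℤ) :
    fcoeff L (fun x => (f x : ℂ)) k = ((L ^ 2)⁻¹ : ℝ) *
      ((∫ x in Dom L, f x * cosMode L k x : ℝ) - (∫ x in Dom L, f x * sinMode L k x : ℝ) *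
        Complex.I) := by
  have bdd : ∀ {ψ : (Fin 2 → ℝ) → ℝ}, Continuous ψ →
      Integrable (fun x => f x * ψ x) (volume.restrict (Dom L)) := by
    intro ψ hψ
    obtain ⟨C, hC⟩ := (isCompact_Dom L).exists_bound_of_continuousOn hψ.continuousOn
    exact hf.mul_bdd (c := C) hψ.aestronglyMeasurable
      ((ae_restrict_iff' (isCompact_Dom L).measurableSet).2 (.of_forall hC))
  have hc : Continuous (cosMode L k) := Real.continuous_cos.comp (continuous_phase L k)
  have hs : Continuous (sinMode L k) := Real.continuous_sin.comp (continuous_phase L k)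
  rw [fcoeff]
  congr 1
  rw [← integral_complex_ofReal, ← integral_complex_ofReal, ← integral_mul_const,
    ← integral_sub (bdd hc).ofReal ((bdd hs).ofReal.mul_const _)]
  congr 1
  ext x
  rw [expo, phase_neg, Complex.exp_mul_I, ← Complex.ofReal_cos, ← Complex.ofReal_sin,
    Real.cos_neg, Real.sin_neg]
  simp only [cosMode, sinMode]
  push_cast
  ring

lemma Lsq_integrable {L : ℝ} (f : Lsq L) : Integrable f (volume.restrict (Dom L)) :=
  (Lp.memLp f).integrable (by norm_num)

/-- Differentiation multiplies the Fourier coefficients by `i 2π/L k_j`. -/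
theorem HasWeakPartial.rcoeff {L : ℝ} (hL : 0 < L) {f g : Lsq L} {j : Fin 2}
    (h : HasWeakPartial L f g j) (k : Fin 2 → ℤ) :
    rcoeff g k = Complex.I * (2 * Real.pi / L * k j : ℝ) * rcoeff f k := by
  have h1 := h _ (isPeriodicTest_cosMode hL k)
  have h2 := h _ (isPeriodicTest_sinMode hL k)
  rw [pderiv_cosMode] at h1
  rw [pderiv_sinMode] at h2
  simp only [mul_left_comm _ (_ * (k j : ℝ)), mul_left_comm _ (-(_ * (k j : ℝ))),
    integral_const_mul] at h1 h2
  rw [StochNS.rcoeff, StochNS.rcoeff, fcoeff_ofReal (Lsq_integrable f),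
    fcoeff_ofReal (Lsq_integrable g)]
  have h1' : ∫ x in Dom L, g x * cosMode L k x
      = (2 * Real.pi / L * k j) * ∫ x in Dom L, f x * sinMode L k x := by linarith
  have h2' : ∫ x in Dom L, g x * sinMode L k x
      = -((2 * Real.pi / L * k j) * ∫ x in Dom L, f x * cosMode L k x) := by linarith
  rw [h1', h2']
  push_cast
  linear_combination ((L ^ 2 : ℂ)⁻¹ * (2 * Real.pi / L * k j) *
    ((∫ x in Dom L, f x * sinMode L k x : ℝ) : ℂ)) * Complex.I_sq

/-! ### Plane waves -/

/-- The plane wave with profile `ψ` and amplitude `a` orthogonal to `∇ψ`, an element of `V`. -/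
def wave {L : ℝ} (hL : 0 < L) {ψ : (Fin 2 → ℝ) → ℝ} (hψ : IsPeriodicTest L ψ) (a : Fin 2 → ℝ)
    (ha : ∀ x, ∑ i, a i * pderiv i ψ x = 0) (h0 : ∫ x in Dom L, ψ x = 0) : V L :=
  ⟨⟨WithLp.toLp 2
      ((⟨WithLp.toLp 2 fun i => a i • ofCont L ψ hψ.continuous, fun i => by
        rw [integral_smul_mul, integral_ofCont_mul]; simp [h0]⟩ : meanZero L),
      (WithLp.toLp 2 fun ij : Fin 2 × Fin 2 =>
        a ij.1 • ofCont L (pderiv ij.2 ψ) (hψ.continuous_pderiv ij.2) :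
        PiLp 2 fun _ : Fin 2 × Fin 2 => Lsq L)),
      fun i j => (hasWeakPartial_ofCont hL hψ j).smul (a i)⟩,
    fun φ hφ => by
      have h : ∀ i, ∫ x in Dom L, (a i • ofCont L ψ hψ.continuous : Lsq L) x * pderiv i φ x
          = - ∫ x in Dom L, (a i * pderiv i ψ x) * φ x := by
        intro i
        rw [integral_smul_mul, integral_ofCont_mul, integral_mul_pderiv hL hφ hψ,
          mul_neg, ← integral_const_mul]
        simp only [mul_assoc]
      refine (Finset.sum_congr rfl fun i _ => h i).trans ?_
      have int : ∀ i, Integrable (fun x => a i * pderiv i ψ x * φ x)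
          (volume.restrict (Dom L)) := fun i => integrable_Dom
        ((continuous_const.mul (hψ.continuous_pderiv i)).mul hφ.continuous)
      rw [Finset.sum_neg_distrib, ← integral_finsetSum _ fun i _ => int i]
      simp [← Finset.sum_mul, ha]⟩

section wave

variable {L : ℝ} (hL : 0 < L) {ψ : (Fin 2 → ℝ) → ℝ} (hψ : IsPeriodicTest L ψ) (a : Fin 2 → ℝ)
    (ha : ∀ x, ∑ i, a i * pderiv i ψ x = 0) (h0 : ∫ x in Dom L, ψ x = 0)

lemma comp_wave (i : Fin 2) :
    comp (toL2 L (wave hL hψ a ha h0)) i = a i • ofCont L ψ hψ.continuous := rfl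

lemma entry_wave (i j : Fin 2) : entry (grad L (wave hL hψ a ha h0)) i j
    = a i • ofCont L (pderiv j ψ) (hψ.continuous_pderiv j) := rfl

lemma inner_L2v (u v : L2v L) : inner ℝ u v = ∑ i, inner ℝ (comp u i) (comp v i) :=
  PiLp.inner_apply (𝕜 := ℝ) (f := fun _ : Fin 2 => Lsq L) _ _

lemma inner_L2t (u v : L2t L) :
    inner ℝ u v = ∑ i, ∑ j, inner ℝ (entry u i j) (entry v i j) :=
  (PiLp.inner_apply (𝕜 := ℝ) (f := fun _ : Fin 2 × Fin 2 => Lsq L) _ _).trans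
    (Fintype.sum_prod_type _)

lemma inner_W12 (u v : W12 L) :
    inner ℝ u v = inner ℝ (toL2 L u) (toL2 L v) + inner ℝ (grad L u) (grad L v) :=
  WithLp.prod_inner_apply (𝕜 := ℝ) (E := L2v L) (F := L2t L) _ _

lemma hasWeakPartial_W12 (u : W12 L) (i j : Fin 2) :
    HasWeakPartial L (comp (toL2 L u) i) (entry (grad L u) i j) j := u.2 i j

lemma inner_wave (u : L2v L) : inner ℝ u (toL2 L (wave hL hψ a ha h0))
    = ∑ i, a i * ∫ x in Dom L, comp u i x * ψ x := by
  simp only [inner_L2v, comp_wave, inner_smul_right, inner_ofCont]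

lemma inner_grad_wave (u : W12 L) (hψ' : ∀ j, IsPeriodicTest L (pderiv j ψ)) {c : ℝ}
    (hc : ∀ x, ∑ j, pderiv j (pderiv j ψ) x = - c * ψ x) :
    inner ℝ (grad L u) (grad L (wave hL hψ a ha h0))
      = c * ∑ i, a i * ∫ x in Dom L, comp (toL2 L u) i x * ψ x := by
  rw [inner_L2t, Finset.mul_sum]
  refine Finset.sum_congr rfl fun i _ => ?_
  simp only [entry_wave, inner_smul_right, inner_ofCont, ← Finset.mul_sum]
  rw [mul_left_comm]
  congr 1
  have h : ∀ j, ∫ x in Dom L, entry (grad L u) i j x * pderiv j ψ x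
      = - ∫ x in Dom L, comp (toL2 L u) i x * pderiv j (pderiv j ψ) x := fun j => by
    rw [hasWeakPartial_W12 u i j _ (hψ' j), neg_neg]
  rw [Finset.sum_congr rfl fun j _ => h j, Finset.sum_neg_distrib, ← integral_finsetSum _
    fun j _ => integrable_mul_of_continuous _ ((hψ' j).continuous_pderiv j),
    ← integral_const_mul, ← integral_neg]
  congr 1
  ext x
  rw [← Finset.mul_sum, hc]
  ring

lemma trilin_wave (u : W12 L) : trilin u u (wave hL hψ a ha h0)
    = ∑ i, a i * ∑ j, ∫ x in Dom L,
        (comp (toL2 L u) j x * entry (grad L u) i j x) * ψ x := by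
  have int : ∀ i j, Integrable
      (fun x => (comp (toL2 L u) j x * entry (grad L u) i j x) * ψ x)
      (volume.restrict (Dom L)) := by
    intro i j
    obtain ⟨C, hC⟩ := (isCompact_Dom L).exists_bound_of_continuousOn hψ.continuous.continuousOn
    exact ((Lp.memLp _).integrable_mul (Lp.memLp _)).mul_bdd (c := C)
      hψ.continuous.aestronglyMeasurable
      ((ae_restrict_iff' (isCompact_Dom L).measurableSet).2 (.of_forall hC))
  have h : (fun x => ∑ i, ∑ j, comp (toL2 L u) j x * entry (grad L u) i j x
      * comp (toL2 L (wave hL hψ a ha h0)) i x) =ᵐ[volume.restrict (Dom L)]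
      fun x => ∑ i, a i * ∑ j, (comp (toL2 L u) j x * entry (grad L u) i j x) * ψ x := by
    have h1 : ∀ i, comp (toL2 L (wave hL hψ a ha h0)) i =ᵐ[volume.restrict (Dom L)]
        fun x => a i * ψ x := by
      intro i
      rw [comp_wave]
      filter_upwards [Lp.coeFn_smul (a i) (ofCont L ψ hψ.continuous),
        coeFn_ofCont L hψ.continuous] with x hx hx'
      rw [hx, Pi.smul_apply, hx', smul_eq_mul]
    filter_upwards [h1 0, h1 1] with x hx0 hx1
    simp only [Fin.sum_univ_two, hx0, hx1]
    ring
  rw [trilin, integral_congr_ae h, integral_finsetSum _ fun i _ =>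
    (integrable_finsetSum _ fun j _ => int i j).const_mul _]
  refine Finset.sum_congr rfl fun i _ => ?_
  rw [integral_const_mul, integral_finsetSum _ fun j _ => int i j]

end wave

lemma integral_modes_eq_zero {L : ℝ} (hL : 0 < L) {k : Fin 2 → ℤ} (hk : k ≠ 0) :
    ∫ x in Dom L, cosMode L k x = 0 ∧ ∫ x in Dom L, sinMode L k x = 0 := by
  obtain ⟨j, hj⟩ := Function.ne_iff.1 hk
  have hc : 2 * Real.pi / L * k j ≠ 0 := by
    have : (k j : ℝ) ≠ 0 := by exact_mod_cast hj
    positivity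
  have h1 := integral_pderiv_eq_zero hL (isPeriodicTest_sinMode hL k) j
  have h2 := integral_pderiv_eq_zero hL (isPeriodicTest_cosMode hL k) j
  rw [pderiv_sinMode, integral_const_mul] at h1
  rw [pderiv_cosMode, integral_const_mul] at h2
  exact ⟨(mul_eq_zero.1 h1).resolve_left hc, (mul_eq_zero.1 h2).resolve_left (neg_ne_zero.2 hc)⟩

/-- The components of `k^⊥`. -/
def perp (k : Fin 2 → ℤ) : Fin 2 → ℝ := ![-(k 1 : ℝ), k 0]

/-- The squared length of a frequency. -/
def lenSq (k : Fin 2 → ℤ) : ℝ := (k 0 : ℝ) ^ 2 + (k 1 : ℝ) ^ 2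

/-- The weak form tested against plane waves, in terms of Fourier coefficients. -/
theorem fourier_equation {L : ℝ} (hL : 0 < L) (u z : W12 L) (h ν : ℝ)
    (heq : ∀ φ : V L, inner ℝ (toL2 L u - toL2 L z) (toL2 L φ)
      + h * (ν * inner ℝ (grad L u) (grad L φ) + trilin u u φ) = 0)
    {k : Fin 2 → ℤ} (hk : k ≠ 0) :
    ∑ i, (perp k i : ℂ) * ((1 + h * ν * ((2 * Real.pi / L) ^ 2 * lenSq k) : ℝ)
        * rcoeff (comp (toL2 L u) i) k
      - rcoeff (comp (toL2 L z) i) k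
      + h * ∑ j, fcoeff L (fun x => (comp (toL2 L u) j x * entry (grad L u) i j x : ℝ)) k) = 0 := by
  have main : ∀ {ψ : (Fin 2 → ℝ) → ℝ} (hψ : IsPeriodicTest L ψ)
      (hψ' : ∀ j, IsPeriodicTest L (pderiv j ψ))
      (ha : ∀ x, ∑ i, perp k i * pderiv i ψ x = 0) (h0 : ∫ x in Dom L, ψ x = 0)
      (hc : ∀ x, ∑ j, pderiv j (pderiv j ψ) x = - ((2 * Real.pi / L) ^ 2 * lenSq k) * ψ x),
      ∑ i, perp k i * ((1 + h * ν * ((2 * Real.pi / L) ^ 2 * lenSq k))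
        * (∫ x in Dom L, comp (toL2 L u) i x * ψ x)
        - (∫ x in Dom L, comp (toL2 L z) i x * ψ x)
        + h * ∑ j, ∫ x in Dom L, (comp (toL2 L u) j x * entry (grad L u) i j x) * ψ x) = 0 := by
    intro ψ hψ hψ' ha h0 hc
    have := heq (wave hL hψ (perp k) ha h0)
    rw [inner_sub_left, inner_wave, inner_wave, inner_grad_wave hL hψ _ ha h0 u hψ' hc,
      trilin_wave] at this
    rw [← this]
    simp only [Fin.sum_univ_two]
    ring
  obtain ⟨hc0, hs0⟩ := integral_modes_eq_zero hL hk
  have hcos := main (isPeriodicTest_cosMode hL k)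
    (fun j => by rw [pderiv_cosMode]; exact (isPeriodicTest_sinMode hL k).const_mul _)
    (fun x => by simp [pderiv_cosMode, Fin.sum_univ_two, perp]; ring) hc0
    (fun x => by
      simp only [pderiv_cosMode, pderiv_const_mul _ (isPeriodicTest_sinMode hL k),
        pderiv_sinMode, Fin.sum_univ_two, lenSq]; ring)
  have hsin := main (isPeriodicTest_sinMode hL k)
    (fun j => by rw [pderiv_sinMode]; exact (isPeriodicTest_cosMode hL k).const_mul _)
    (fun x => by simp [pderiv_sinMode, Fin.sum_univ_two, perp]; ring) hs0
    (fun x => by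
      simp only [pderiv_sinMode, pderiv_const_mul _ (isPeriodicTest_cosMode hL k),
        pderiv_cosMode, Fin.sum_univ_two, lenSq]; ring)
  have hprod : ∀ i j, fcoeff L (fun x => (comp (toL2 L u) j x * entry (grad L u) i j x : ℝ)) k
      = _ := fun i j => fcoeff_ofReal ((Lp.memLp _).integrable_mul (Lp.memLp _)) k
  simp only [hprod, rcoeff, fcoeff_ofReal (Lsq_integrable _), Fin.sum_univ_two] at hcos hsin ⊢
  have hcos' := congrArg (fun r : ℝ => (r : ℂ)) hcos
  have hsin' := congrArg (fun r : ℝ => (r : ℂ)) hsin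
  push_cast at hcos' hsin' ⊢
  linear_combination ((L : ℂ) ^ 2)⁻¹ * hcos' - ((L : ℂ) ^ 2)⁻¹ * Complex.I * hsin'

/-! ### Frequencies -/

/-- The length of a frequency. -/
def len (k : Fin 2 → ℤ) : ℝ := Real.sqrt (lenSq k)

/-- The cross product of two frequencies. -/
def cross (p q : Fin 2 → ℤ) : ℝ := p 0 * q 1 - p 1 * q 0

/-- The dot product of two frequencies. -/
def dot (p q : Fin 2 → ℤ) : ℝ := p 0 * q 0 + p 1 * q 1

lemma lenSq_nonneg (k : Fin 2 → ℤ) : 0 ≤ lenSq k := by unfold lenSq; positivity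

lemma len_nonneg (k : Fin 2 → ℤ) : 0 ≤ len k := Real.sqrt_nonneg _

lemma len_sq (k : Fin 2 → ℤ) : len k ^ 2 = lenSq k := Real.sq_sqrt (lenSq_nonneg k)

lemma one_le_lenSq {k : Fin 2 → ℤ} (hk : k ≠ 0) : 1 ≤ lenSq k := by
  have h : 1 ≤ k 0 ^ 2 + k 1 ^ 2 := by
    by_contra! h
    refine hk (funext fun i => ?_)
    have h0 : k 0 ^ 2 = 0 := by nlinarith [sq_nonneg (k 0), sq_nonneg (k 1)]
    have h1 : k 1 ^ 2 = 0 := by nlinarith [sq_nonneg (k 0), sq_nonneg (k 1)]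
    fin_cases i
    · simpa using h0
    · simpa using h1
  unfold lenSq
  exact_mod_cast h

lemma lenSq_pos {k : Fin 2 → ℤ} (hk : k ≠ 0) : 0 < lenSq k :=
  zero_lt_one.trans_le (one_le_lenSq hk)

lemma len_pos {k : Fin 2 → ℤ} (hk : k ≠ 0) : 0 < len k := Real.sqrt_pos.2 (lenSq_pos hk)

lemma one_le_len {k : Fin 2 → ℤ} (hk : k ≠ 0) : 1 ≤ len k :=
  Real.one_le_sqrt.2 (one_le_lenSq hk)

lemma len_zero : len 0 = 0 := by simp [len, lenSq]

lemma lenSq_zero : lenSq 0 = 0 := by simp [lenSq]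

lemma lenSq_neg (k : Fin 2 → ℤ) : lenSq (-k) = lenSq k := by simp [lenSq]

lemma len_neg (k : Fin 2 → ℤ) : len (-k) = len k := by rw [len, lenSq_neg, len]

lemma sq_le_len_mul {p q : Fin 2 → ℤ} {x : ℝ} (h : x ^ 2 ≤ lenSq p * lenSq q) :
    |x| ≤ len p * len q := by
  rw [len, len, ← Real.sqrt_mul (lenSq_nonneg p)]
  exact Real.abs_le_sqrt h

lemma abs_cross_le (p q : Fin 2 → ℤ) : |cross p q| ≤ len p * len q :=
  sq_le_len_mul (by unfold cross lenSq; nlinarith [sq_nonneg ((p 0 : ℝ) * q 0 + p 1 * q 1)])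

lemma abs_dot_le (p q : Fin 2 → ℤ) : |dot p q| ≤ len p * len q :=
  sq_le_len_mul (by unfold dot lenSq; nlinarith [sq_nonneg ((p 0 : ℝ) * q 1 - p 1 * q 0)])

lemma len_add_le (p q : Fin 2 → ℤ) : len (p + q) ≤ len p + len q := by
  refine Real.sqrt_le_iff.2 ⟨add_nonneg (len_nonneg p) (len_nonneg q), ?_⟩
  have h : lenSq (p + q) = len p ^ 2 + len q ^ 2 + 2 * dot p q := by
    rw [len_sq, len_sq]; simp [lenSq, dot]; ring
  have := (le_abs_self _).trans (abs_dot_le p q)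
  rw [h]; nlinarith

/-- The length of a frequency, as an extended nonnegative real. -/
def elen (k : Fin 2 → ℤ) : ℝ≥0∞ := ENNReal.ofReal (len k)

/-- The inverse length of a frequency, with value `0` at `0`. -/
def ilen (k : Fin 2 → ℤ) : ℝ≥0∞ := ENNReal.ofReal (len k)⁻¹

lemma ilen_mul_elen {k : Fin 2 → ℤ} (hk : k ≠ 0) : ilen k * elen k = 1 := by
  rw [ilen, elen, ← ENNReal.ofReal_mul (inv_nonneg.2 (len_nonneg k)),
    inv_mul_cancel₀ (len_pos hk).ne', ENNReal.ofReal_one]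

lemma ilen_zero : ilen 0 = 0 := by simp [ilen, len_zero]

lemma elen_zero : elen 0 = 0 := by simp [elen, len_zero]

lemma ilen_le_one (k : Fin 2 → ℤ) : ilen k ≤ 1 := by
  rcases eq_or_ne k 0 with rfl | hk
  · simp [ilen_zero]
  · exact ENNReal.ofReal_le_one.2 (inv_le_one_of_one_le₀ (one_le_len hk))

lemma elen_add_le (p q : Fin 2 → ℤ) : elen (p + q) ≤ elen p + elen q := by
  rw [elen, elen, elen, ← ENNReal.ofReal_add (len_nonneg p) (len_nonneg q)]
  exact ENNReal.ofReal_le_ofReal (len_add_le p q)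

lemma tsum_ilen_cube_ne_top : ∑' k, ilen k ^ 3 ≠ ∞ := by
  have h := EisensteinSeries.summable_one_div_norm_rpow (k := 3) (by norm_num)
  have h' : Summable fun k : Fin 2 → ℤ => ((len k)⁻¹) ^ 3 := by
    refine Summable.of_nonneg_of_le (fun k => pow_nonneg (inv_nonneg.2 (len_nonneg k)) 3)
      (fun k => ?_) h
    rcases eq_or_ne k 0 with rfl | hk
    · simp [len_zero]
    have hn : ‖k‖ ≤ len k := by
      refine (pi_norm_le_iff_of_nonneg (len_nonneg k)).2 fun i => ?_
      rw [Int.norm_eq_abs]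
      refine Real.abs_le_sqrt ?_
      unfold lenSq
      fin_cases i
      · simpa using sq_nonneg (k 1 : ℝ)
      · simpa using sq_nonneg (k 0 : ℝ)
    rw [Real.rpow_neg (norm_nonneg _)]
    have : (‖k‖⁻¹ : ℝ) ^ (3 : ℕ) = (‖k‖ ^ (3 : ℝ))⁻¹ := by
      rw [inv_pow]; norm_cast
    rw [← this]
    have := norm_pos_iff.2 hk
    have := inv_nonneg.2 (len_nonneg k)
    gcongr
  have := h'.tsum_ofReal_ne_top
  simpa only [ilen, ENNReal.ofReal_pow (inv_nonneg.2 (len_nonneg _))] using this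

/-! ### Sums of extended nonnegative reals -/

lemma tsum_mul_sq_le {ι : Type*} (f g : ι → ℝ≥0∞) :
    (∑' i, f i * g i) ^ 2 ≤ (∑' i, f i ^ 2) * ∑' i, g i ^ 2 := by
  let _ : MeasurableSpace ι := ⊤
  have h := ENNReal.lintegral_mul_le_Lp_mul_Lq (Measure.count : Measure ι)
    Real.HolderConjugate.two_two (f := f) (g := g)
    (Measurable.of_discrete.aemeasurable) (Measurable.of_discrete.aemeasurable)
  simp only [lintegral_count, Pi.mul_apply] at h
  calc (∑' i, f i * g i) ^ 2 ≤ _ := pow_le_pow_left' h 2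
    _ = _ := by
      rw [mul_pow, ← ENNReal.rpow_natCast, ← ENNReal.rpow_natCast, ← ENNReal.rpow_mul,
        ← ENNReal.rpow_mul]
      simp

lemma add_sq_le_four_mul (x y : ℝ≥0∞) : (x + y) ^ 2 ≤ 4 * (x ^ 2 + y ^ 2) := by
  rcases le_total x y with h | h
  · calc (x + y) ^ 2 ≤ (y + y) ^ 2 := by gcongr
      _ = 4 * y ^ 2 := by ring
      _ ≤ _ := by gcongr; exact le_add_self
  · calc (x + y) ^ 2 ≤ (x + x) ^ 2 := by gcongr
      _ = 4 * x ^ 2 := by ring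
      _ ≤ _ := by gcongr; exact le_self_add

lemma tsum_sub_right (f : (Fin 2 → ℤ) → ℝ≥0∞) (p : Fin 2 → ℤ) : ∑' k, f (k - p) = ∑' k, f k :=
  (Equiv.subRight p).tsum_eq f

lemma tsum_sub_left (f : (Fin 2 → ℤ) → ℝ≥0∞) (k : Fin 2 → ℤ) : ∑' p, f (k - p) = ∑' p, f p :=
  (Equiv.subLeft k).tsum_eq f

/-- **Young's inequality** `ℓ¹ * ℓ² ⊆ ℓ²`. -/
lemma tsum_convolution_sq_le (f g : (Fin 2 → ℤ) → ℝ≥0∞) :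
    ∑' k, (∑' p, f p * g (k - p)) ^ 2 ≤ (∑' p, f p) ^ 2 * ∑' p, g p ^ 2 := by
  have hs : ∀ x : ℝ≥0∞, (x ^ (1 / 2 : ℝ)) ^ 2 = x := fun x => by
    rw [← ENNReal.rpow_natCast, ← ENNReal.rpow_mul]; simp
  have h : ∀ k, (∑' p, f p * g (k - p)) ^ 2 ≤ (∑' p, f p) * ∑' p, f p * g (k - p) ^ 2 := by
    intro k
    have := tsum_mul_sq_le (fun p => f p ^ (1 / 2 : ℝ)) (fun p => f p ^ (1 / 2 : ℝ) * g (k - p))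
    simp only [mul_pow, hs, ← mul_assoc, ← sq] at this
    exact this
  refine (ENNReal.tsum_le_tsum h).trans_eq ?_
  rw [ENNReal.tsum_mul_left, ENNReal.tsum_comm]
  simp_rw [ENNReal.tsum_mul_left, tsum_sub_right (fun k => g k ^ 2), ENNReal.tsum_mul_right]
  ring

lemma sq_mul_sq_mul_sq_le (x y z : ℝ≥0∞) :
    x ^ 2 * y ^ 2 * z ^ 2 ≤ x ^ 3 * y ^ 3 + y ^ 3 * z ^ 3 + z ^ 3 * x ^ 3 := by
  have key : ∀ x y z : ℝ≥0∞, z ≤ x → z ≤ y → x ^ 2 * y ^ 2 * z ^ 2 ≤ x ^ 3 * y ^ 3 := by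
    intro x y z hx hy
    calc x ^ 2 * y ^ 2 * z ^ 2 = x ^ 2 * y ^ 2 * (z * z) := by ring
      _ ≤ x ^ 2 * y ^ 2 * (x * y) := by gcongr
      _ = _ := by ring
  have h1 : z ≤ x → z ≤ y → x ^ 2 * y ^ 2 * z ^ 2 ≤ x ^ 3 * y ^ 3 + y ^ 3 * z ^ 3 + z ^ 3 * x ^ 3 :=
    fun a b => (key x y z a b).trans (le_self_add.trans le_self_add)
  have h2 : x ≤ y → x ≤ z → x ^ 2 * y ^ 2 * z ^ 2 ≤ x ^ 3 * y ^ 3 + y ^ 3 * z ^ 3 + z ^ 3 * x ^ 3 :=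
    fun a b => (((by ring : x ^ 2 * y ^ 2 * z ^ 2 = y ^ 2 * z ^ 2 * x ^ 2).le.trans
      (key y z x a b)).trans le_add_self).trans le_self_add
  have h3 : y ≤ z → y ≤ x → x ^ 2 * y ^ 2 * z ^ 2 ≤ x ^ 3 * y ^ 3 + y ^ 3 * z ^ 3 + z ^ 3 * x ^ 3 :=
    fun a b => ((by ring : x ^ 2 * y ^ 2 * z ^ 2 = z ^ 2 * x ^ 2 * y ^ 2).le.trans
      (key z x y a b)).trans le_add_self
  rcases le_total x y with hxy | hxy
  · rcases le_total x z with hxz | hxz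
    · exact h2 hxy hxz
    · exact h1 hxz (hxz.trans hxy)
  · rcases le_total y z with hyz | hyz
    · exact h3 hyz hxy
    · exact h1 (hyz.trans hxy) hyz

lemma tsum_ilen_triple_ne_top :
    ∑' k, ∑' p, ilen k ^ 2 * ilen p ^ 2 * ilen (k - p) ^ 2 ≠ ∞ := by
  set S := ∑' k, ilen k ^ 3
  have hS : S ≠ ∞ := tsum_ilen_cube_ne_top
  have h1 : ∑' k, ∑' p, ilen k ^ 3 * ilen p ^ 3 = S * S := by
    simp_rw [ENNReal.tsum_mul_left, ENNReal.tsum_mul_right]; rfl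
  have h2 : ∑' k, ∑' p, ilen p ^ 3 * ilen (k - p) ^ 3 = S * S := by
    rw [ENNReal.tsum_comm]
    simp_rw [ENNReal.tsum_mul_left, tsum_sub_right (fun k => ilen k ^ 3), ENNReal.tsum_mul_right]
    rfl
  have h3 : ∑' k, ∑' p, ilen (k - p) ^ 3 * ilen k ^ 3 = S * S := by
    simp_rw [ENNReal.tsum_mul_right, tsum_sub_left (fun k => ilen k ^ 3), ENNReal.tsum_mul_left]
    rfl
  have h : ∑' k, ∑' p, ilen k ^ 2 * ilen p ^ 2 * ilen (k - p) ^ 2 ≤ S * S + S * S + S * S := by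
    nth_rw 3 [← h3]; nth_rw 2 [← h2]; nth_rw 1 [← h1]
    simp_rw [← ENNReal.tsum_add]
    exact ENNReal.tsum_le_tsum fun k => ENNReal.tsum_le_tsum fun p => sq_mul_sq_mul_sq_le _ _ _
  exact ne_top_of_le_ne_top (by finiteness) h

/-- The convolution of two `h¹` sequences is summable against the inverse length. -/
lemma tsum_ilen_convolution_ne_top {w : (Fin 2 → ℤ) → ℝ≥0∞} (hw : ∑' k, w k ^ 2 ≠ ∞) :
    ∑' k, ilen k * ∑' p, (w p * ilen p) * (w (k - p) * ilen (k - p)) ≠ ∞ := by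
  have h := tsum_mul_sq_le
    (fun x : (Fin 2 → ℤ) × (Fin 2 → ℤ) => ilen x.1 * ilen x.2 * ilen (x.1 - x.2))
    (fun x => w x.2 * w (x.1 - x.2))
  simp only [mul_pow, ENNReal.tsum_prod'] at h
  have h2 : ∑' k, ∑' p, w p ^ 2 * w (k - p) ^ 2 = (∑' k, w k ^ 2) * ∑' k, w k ^ 2 := by
    rw [ENNReal.tsum_comm]
    simp_rw [ENNReal.tsum_mul_left, tsum_sub_right (fun k => w k ^ 2), ENNReal.tsum_mul_right]
  rw [h2] at h
  have h3 := ne_top_of_le_ne_top (ENNReal.mul_ne_top tsum_ilen_triple_ne_top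
    (ENNReal.mul_ne_top hw hw)) h
  have h4 : ∑' k, ilen k * ∑' p, (w p * ilen p) * (w (k - p) * ilen (k - p))
      = ∑' k, ∑' p, ilen k * ilen p * ilen (k - p) * (w p * w (k - p)) := by
    simp_rw [← ENNReal.tsum_mul_left]
    congr! 4
    ring
  rw [h4]
  exact fun h5 => h3 (by rw [h5]; simp)

/-! ### The vorticity equation in Fourier space -/

/-- The summand of the nonlinear term of the vorticity equation. -/
def nlTerm (ω : (Fin 2 → ℤ) → ℂ) (q p : Fin 2 → ℤ) : ℂ :=
  ω q * ω p * (cross q p * dot (q + p) p / (lenSq q * lenSq p) : ℝ)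

/-- The nonlinear term of the vorticity equation. -/
def nl (ω : (Fin 2 → ℤ) → ℂ) (k : Fin 2 → ℤ) : ℂ := ∑' p, nlTerm ω (k - p) p

lemma cross_add_left (q p : Fin 2 → ℤ) : cross q (q + p) = cross q p := by
  simp [cross]; ring

lemma enorm_nlTerm_le (ω : (Fin 2 → ℤ) → ℂ) (q p : Fin 2 → ℤ) :
    ‖nlTerm ω q p‖ₑ ≤ elen (q + p) ^ 2 * ((‖ω p‖ₑ * ilen p) * (‖ω q‖ₑ * ilen q)) := by
  rcases eq_or_ne q 0 with rfl | hq
  · simp [nlTerm, lenSq_zero]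
  rcases eq_or_ne p 0 with rfl | hp
  · simp [nlTerm, lenSq_zero]
  have h : |cross q p * dot (q + p) p / (lenSq q * lenSq p)|
      ≤ len (q + p) ^ 2 * ((len p)⁻¹ * (len q)⁻¹) := by
    have hq' := len_pos hq
    have hp' := len_pos hp
    rw [abs_div, abs_mul, ← cross_add_left, abs_of_pos (mul_pos (lenSq_pos hq) (lenSq_pos hp)),
      ← len_sq, ← len_sq, div_le_iff₀ (by positivity)]
    calc |cross q (q + p)| * |dot (q + p) p| ≤ (len q * len (q + p)) * (len (q + p) * len p) :=
          mul_le_mul (abs_cross_le _ _) (abs_dot_le _ _) (abs_nonneg _)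
            (mul_nonneg (len_nonneg _) (len_nonneg _))
      _ = _ := by field_simp
  calc ‖nlTerm ω q p‖ₑ = ‖ω q‖ₑ * ‖ω p‖ₑ
        * ENNReal.ofReal |cross q p * dot (q + p) p / (lenSq q * lenSq p)| := by
        rw [nlTerm, enorm_mul, enorm_mul, ← ofReal_norm ((_ : ℝ) : ℂ),
          Complex.norm_real, Real.norm_eq_abs]
    _ ≤ ‖ω q‖ₑ * ‖ω p‖ₑ * ENNReal.ofReal (len (q + p) ^ 2 * ((len p)⁻¹ * (len q)⁻¹)) := by
        gcongr
    _ = _ := by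
        rw [ENNReal.ofReal_mul (by positivity), ENNReal.ofReal_mul (inv_nonneg.2 (len_nonneg p)),
          ENNReal.ofReal_pow (len_nonneg _), elen, ilen, ilen]
        ring

lemma enorm_nl_le (ω : (Fin 2 → ℤ) → ℂ) (k : Fin 2 → ℤ) :
    ‖nl ω k‖ₑ ≤ elen k ^ 2 * ∑' p, (‖ω p‖ₑ * ilen p) * (‖ω (k - p)‖ₑ * ilen (k - p)) := by
  refine enorm_tsum_le_tsum_enorm.trans ?_
  rw [← ENNReal.tsum_mul_left]
  refine ENNReal.tsum_le_tsum fun p => ?_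
  simpa using enorm_nlTerm_le ω (k - p) p

section regularity

variable {ω ζ : (Fin 2 → ℤ) → ℂ} {c d : ℝ}

lemma mul_enorm_le_of_equation (hc : 0 < c)
    (heq : ∀ k, ((1 + c * lenSq k : ℝ) : ℂ) * ω k + Complex.I * d * nl ω k = ζ k)
    (k : Fin 2 → ℤ) :
    ENNReal.ofReal c * elen k ^ 2 * ‖ω k‖ₑ ≤ ‖ζ k‖ₑ + ‖d‖ₑ * (elen k ^ 2 *
      ∑' p, (‖ω p‖ₑ * ilen p) * (‖ω (k - p)‖ₑ * ilen (k - p))) := by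
  have h1 : ENNReal.ofReal c * elen k ^ 2 * ‖ω k‖ₑ ≤ ‖((1 + c * lenSq k : ℝ) : ℂ) * ω k‖ₑ := by
    rw [enorm_mul]
    gcongr
    rw [elen, ← ENNReal.ofReal_pow (len_nonneg k), ← ENNReal.ofReal_mul hc.le,
      ← ofReal_norm, Complex.norm_real]
    refine ENNReal.ofReal_le_ofReal (le_trans ?_ (le_abs_self _))
    rw [len_sq]; linarith
  have h2 : ((1 + c * lenSq k : ℝ) : ℂ) * ω k = ζ k - Complex.I * d * nl ω k := by
    rw [← heq k]; ring
  refine h1.trans ?_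
  rw [h2]
  refine enorm_sub_le.trans (add_le_add le_rfl ?_)
  rw [enorm_mul, enorm_mul]
  have : ‖Complex.I‖ₑ = 1 := by simp [enorm_eq_nnnorm]
  have hd : ‖(d : ℂ)‖ₑ = ‖d‖ₑ := by simp [enorm_eq_nnnorm]
  rw [this, one_mul, hd]
  gcongr
  exact enorm_nl_le ω k

variable (hc : 0 < c) (hω : ∑' k, ‖ω k‖ₑ ^ 2 ≠ ∞) (hζ : ∑' k, ‖ζ k‖ₑ ^ 2 ≠ ∞)
  (heq : ∀ k, ((1 + c * lenSq k : ℝ) : ℂ) * ω k + Complex.I * d * nl ω k = ζ k)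

include hc hω hζ heq in
/-- The velocity coefficients are absolutely summable. -/
lemma tsum_enorm_mul_ilen_ne_top : ∑' k, ‖ω k‖ₑ * ilen k ≠ ∞ := by
  set J : (Fin 2 → ℤ) → ℝ≥0∞ := fun k =>
    ∑' p, (‖ω p‖ₑ * ilen p) * (‖ω (k - p)‖ₑ * ilen (k - p)) with hJ
  have hpt : ∀ k, ENNReal.ofReal c * (‖ω k‖ₑ * ilen k)
      ≤ (ilen k ^ 3 + ‖ζ k‖ₑ ^ 2) + ‖d‖ₑ * (ilen k * J k) := by
    intro k
    rcases eq_or_ne k 0 with rfl | hk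
    · simp [ilen_zero]
    have hil := ilen_mul_elen hk
    have h := mul_enorm_le_of_equation hc heq k
    have h3 : ilen k ^ 3 * ‖ζ k‖ₑ ≤ ilen k ^ 3 + ‖ζ k‖ₑ ^ 2 := by
      rcases le_total ‖ζ k‖ₑ 1 with hz | hz
      · exact (mul_le_of_le_one_right' hz).trans le_self_add
      · calc ilen k ^ 3 * ‖ζ k‖ₑ ≤ 1 ^ 3 * ‖ζ k‖ₑ := by gcongr; exact ilen_le_one k
          _ = ‖ζ k‖ₑ := by simp
          _ ≤ ‖ζ k‖ₑ ^ 2 := le_self_pow hz (by norm_num)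
          _ ≤ _ := le_add_self
    calc ENNReal.ofReal c * (‖ω k‖ₑ * ilen k)
        = ilen k ^ 3 * (ENNReal.ofReal c * elen k ^ 2 * ‖ω k‖ₑ) := by
          calc _ = (ilen k * elen k) ^ 2 * (ENNReal.ofReal c * (‖ω k‖ₑ * ilen k)) := by
                rw [hil]; simp
            _ = _ := by ring
      _ ≤ ilen k ^ 3 * (‖ζ k‖ₑ + ‖d‖ₑ * (elen k ^ 2 * J k)) := by gcongr
      _ = ilen k ^ 3 * ‖ζ k‖ₑ + (ilen k * elen k) ^ 2 * (‖d‖ₑ * (ilen k * J k)) := by ring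
      _ ≤ _ := by rw [hil, one_pow, one_mul]; gcongr
  have hsum := ENNReal.tsum_le_tsum hpt
  rw [ENNReal.tsum_mul_left, ENNReal.tsum_add, ENNReal.tsum_add, ENNReal.tsum_mul_left] at hsum
  have hfin := ne_top_of_le_ne_top (ENNReal.add_ne_top.2 ⟨ENNReal.add_ne_top.2
    ⟨tsum_ilen_cube_ne_top, hζ⟩, ENNReal.mul_ne_top enorm_ne_top
    (tsum_ilen_convolution_ne_top hω)⟩) hsum
  intro htop
  rw [htop, ENNReal.mul_top (by simpa using hc)] at hfin
  exact hfin rfl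

include hc hω hζ heq in
/-- The gradient of the vorticity is square summable. -/
lemma tsum_elen_mul_enorm_sq_ne_top : ∑' k, (elen k * ‖ω k‖ₑ) ^ 2 ≠ ∞ := by
  set a : (Fin 2 → ℤ) → ℝ≥0∞ := fun k => ‖ω k‖ₑ * ilen k with ha
  have ha1 : ∑' k, a k ≠ ∞ := tsum_enorm_mul_ilen_ne_top hc hω hζ heq
  have hla : ∀ k, elen k * a k ≤ ‖ω k‖ₑ := by
    intro k
    rcases eq_or_ne k 0 with rfl | hk
    · simp [elen_zero]
    · calc elen k * a k = (ilen k * elen k) * ‖ω k‖ₑ := by simp only [ha]; ring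
        _ ≤ _ := by rw [ilen_mul_elen hk, one_mul]
  have hconv : ∀ k, elen k * ∑' p, a p * a (k - p) ≤ 2 * ∑' p, a p * ‖ω (k - p)‖ₑ := by
    intro k
    have hswap : ∑' p, ‖ω p‖ₑ * a (k - p) = ∑' p, a p * ‖ω (k - p)‖ₑ := by
      rw [← (Equiv.subLeft k).tsum_eq]
      simp [mul_comm]
    rw [two_mul]
    nth_rw 1 [← hswap]
    rw [← ENNReal.tsum_mul_left, ← ENNReal.tsum_add]
    refine ENNReal.tsum_le_tsum fun p => ?_
    calc elen k * (a p * a (k - p)) ≤ (elen p + elen (k - p)) * (a p * a (k - p)) := by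
          gcongr
          simpa using elen_add_le p (k - p)
      _ = (elen p * a p) * a (k - p) + a p * (elen (k - p) * a (k - p)) := by ring
      _ ≤ _ := by gcongr <;> exact hla _
  have hpt : ∀ k, (ENNReal.ofReal c * (elen k * ‖ω k‖ₑ)) ^ 2
      ≤ 4 * (‖ζ k‖ₑ ^ 2 + (2 * ‖d‖ₑ) ^ 2 * (∑' p, a p * ‖ω (k - p)‖ₑ) ^ 2) := by
    intro k
    rcases eq_or_ne k 0 with rfl | hk
    · simp [elen_zero]
    have hil := ilen_mul_elen hk
    have h := mul_enorm_le_of_equation hc heq k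
    rw [← mul_pow]
    refine le_trans ?_ (add_sq_le_four_mul _ _)
    gcongr
    calc ENNReal.ofReal c * (elen k * ‖ω k‖ₑ)
        = ilen k * (ENNReal.ofReal c * elen k ^ 2 * ‖ω k‖ₑ) := by
          calc _ = (ilen k * elen k) * (ENNReal.ofReal c * (elen k * ‖ω k‖ₑ)) := by
                rw [hil, one_mul]
            _ = _ := by ring
      _ ≤ ilen k * (‖ζ k‖ₑ + ‖d‖ₑ * (elen k ^ 2 * ∑' p, a p * a (k - p))) := by gcongr
      _ = ilen k * ‖ζ k‖ₑ + (ilen k * elen k) * (‖d‖ₑ * (elen k * ∑' p, a p * a (k - p))) := by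
          ring
      _ ≤ 1 * ‖ζ k‖ₑ + 1 * (‖d‖ₑ * (2 * ∑' p, a p * ‖ω (k - p)‖ₑ)) := by
          rw [hil]
          exact add_le_add (mul_le_mul_left (ilen_le_one k) _)
            (mul_le_mul_right (mul_le_mul_right (hconv k) _) _)
      _ = _ := by ring
  have hsum := ENNReal.tsum_le_tsum hpt
  simp only [mul_pow (ENNReal.ofReal c)] at hsum
  rw [ENNReal.tsum_mul_left, ENNReal.tsum_mul_left, ENNReal.tsum_add,
    ENNReal.tsum_mul_left] at hsum
  have hy : ∑' k, (∑' p, a p * ‖ω (k - p)‖ₑ) ^ 2 ≠ ∞ :=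
    ne_top_of_le_ne_top (ENNReal.mul_ne_top (ENNReal.pow_ne_top ha1) hω)
      (tsum_convolution_sq_le a (fun k => ‖ω k‖ₑ))
  have hfin := ne_top_of_le_ne_top (ENNReal.mul_ne_top (by norm_num) (ENNReal.add_ne_top.2
    ⟨hζ, ENNReal.mul_ne_top (by finiteness) hy⟩)) hsum
  intro htop
  rw [htop, ENNReal.mul_top (by simpa using hc)] at hfin
  exact hfin rfl

end regularity

/-! ### Cancellation of the nonlinear term -/

lemma summable_of_tsum_enorm_ne_top {ι : Type*} {f : ι → ℂ} (h : ∑' i, ‖f i‖ₑ ≠ ∞) :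
    Summable f :=
  Summable.of_nnnorm (ENNReal.tsum_coe_ne_top_iff_summable.1 h)

lemma tsum_eq_zero_of_antisymm {ι : Type*} (e : ι ≃ ι) {f : ι → ℂ} (h : ∀ i, f (e i) = - f i) :
    ∑' i, f i = 0 := by
  have := e.tsum_eq f
  simp only [h, tsum_neg] at this
  exact self_eq_neg.1 this.symm

lemma enorm_mul_ofReal_le (x : ℂ) {r M : ℝ} (h : |r| ≤ M) : ‖x * (r : ℂ)‖ₑ ≤ ‖x‖ₑ * ENNReal.ofReal M := by
  rw [enorm_mul, ← ofReal_norm (r : ℂ), Complex.norm_real, Real.norm_eq_abs]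
  gcongr

section cancellation

variable {ω : (Fin 2 → ℤ) → ℂ}

/-- The part of the trilinear term with weight `1 / |q|²`. -/
def triLeft (θ : (Fin 2 → ℤ) → ℝ) (ω : (Fin 2 → ℤ) → ℂ) (x : (Fin 2 → ℤ) × (Fin 2 → ℤ)) : ℂ :=
  ω x.1 * ω x.2 * ω (-(x.1 + x.2)) * ((θ (x.1 + x.2) * (cross x.1 x.2 / lenSq x.1) : ℝ) : ℂ)

/-- The part of the trilinear term with weight `q·p / (|q|² |p|²)`. -/
def triMid (θ : (Fin 2 → ℤ) → ℝ) (ω : (Fin 2 → ℤ) → ℂ) (x : (Fin 2 → ℤ) × (Fin 2 → ℤ)) : ℂ :=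
  ω x.1 * ω x.2 * ω (-(x.1 + x.2)) *
    ((θ (x.1 + x.2) * (cross x.1 x.2 * dot x.1 x.2 / (lenSq x.1 * lenSq x.2)) : ℝ) : ℂ)

lemma tri_split (h0 : ω 0 = 0) (θ : (Fin 2 → ℤ) → ℝ) (x : (Fin 2 → ℤ) × (Fin 2 → ℤ)) :
    θ (x.1 + x.2) * (nlTerm ω x.1 x.2 * ω (-(x.1 + x.2))) = triLeft θ ω x + triMid θ ω x := by
  obtain ⟨q, p⟩ := x
  rcases eq_or_ne p 0 with rfl | hp
  · simp [triLeft, triMid, nlTerm, h0]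
  rcases eq_or_ne q 0 with rfl | hq
  · simp [triLeft, triMid, nlTerm, h0]
  have h : cross q p * dot (q + p) p / (lenSq q * lenSq p)
      = cross q p / lenSq q + cross q p * dot q p / (lenSq q * lenSq p) := by
    have h1 := (lenSq_pos hq).ne'
    have h2 := (lenSq_pos hp).ne'
    have h3 : dot (q + p) p = lenSq p + dot q p := by simp [dot, lenSq]; ring
    rw [h3]
    field_simp
  simp only [nlTerm, triLeft, triMid, h]
  push_cast
  ring

lemma cross_neg_add_left (q p : Fin 2 → ℤ) : cross (-(q + p)) p = - cross q p := by
  simp [cross]; ring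

lemma cross_neg_add_right (q p : Fin 2 → ℤ) : cross q (-(q + p)) = - cross q p := by
  simp [cross]; ring

lemma cross_swap (q p : Fin 2 → ℤ) : cross p q = - cross q p := by
  simp [cross]; ring

lemma dot_swap (q p : Fin 2 → ℤ) : dot p q = dot q p := by
  simp [dot]; ring

/-- The involution `(q, p) ↦ (-(q + p), p)`. -/
def swapLeft : ((Fin 2 → ℤ) × (Fin 2 → ℤ)) ≃ ((Fin 2 → ℤ) × (Fin 2 → ℤ)) where
  toFun x := (-(x.1 + x.2), x.2)
  invFun x := (-(x.1 + x.2), x.2)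
  left_inv x := by simp
  right_inv x := by simp

/-- The involution `(q, p) ↦ (q, -(q + p))`. -/
def swapRight : ((Fin 2 → ℤ) × (Fin 2 → ℤ)) ≃ ((Fin 2 → ℤ) × (Fin 2 → ℤ)) where
  toFun x := (x.1, -(x.1 + x.2))
  invFun x := (x.1, -(x.1 + x.2))
  left_inv x := by simp
  right_inv x := by simp

lemma tsum_triMid (θ : (Fin 2 → ℤ) → ℝ) : ∑' x, triMid θ ω x = 0 := by
  refine tsum_eq_zero_of_antisymm (Equiv.prodComm _ _) fun ⟨q, p⟩ => ?_
  simp only [triMid, Equiv.prodComm_apply, Prod.swap_prod_mk, add_comm p q, cross_swap q p,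
    dot_swap q p, mul_comm (lenSq p)]
  push_cast
  ring

lemma tsum_triLeft_one : ∑' x, triLeft (fun _ => 1) ω x = 0 := by
  refine tsum_eq_zero_of_antisymm swapRight fun ⟨q, p⟩ => ?_
  have h : -(q + -(q + p)) = p := by abel
  simp only [triLeft, swapRight, Equiv.coe_fn_mk, cross_neg_add_right, h]
  push_cast
  ring

lemma tsum_triLeft_inv : ∑' x, triLeft (fun k => (lenSq k)⁻¹) ω x = 0 := by
  refine tsum_eq_zero_of_antisymm swapLeft fun ⟨q, p⟩ => ?_
  have h : -(q + p) + p = -q := by abel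
  simp only [triLeft, swapLeft, Equiv.coe_fn_mk, cross_neg_add_left, h, lenSq_neg, neg_neg]
  push_cast
  ring

variable (hω : ∑' k, ‖ω k‖ₑ ^ 2 ≠ ∞) (h1 : ∑' k, ‖ω k‖ₑ * ilen k ≠ ∞)
  (h2 : ∑' k, (elen k * ‖ω k‖ₑ) ^ 2 ≠ ∞)

include hω h1 h2 in
lemma tsum_dominant_ne_top : ∑' x : (Fin 2 → ℤ) × (Fin 2 → ℤ),
    (‖ω x.1‖ₑ * ilen x.1) * (‖ω x.2‖ₑ * (elen (x.1 + x.2) * ‖ω (-(x.1 + x.2))‖ₑ)) ≠ ∞ := by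
  rw [ENNReal.tsum_prod']
  simp_rw [ENNReal.tsum_mul_left]
  set M := (∑' k, ‖ω k‖ₑ ^ 2) * ∑' k, (elen k * ‖ω k‖ₑ) ^ 2 with hM
  have hM' : M ≠ ∞ := ENNReal.mul_ne_top hω h2
  have hb : ∀ q, ∑' p, ‖ω p‖ₑ * (elen (q + p) * ‖ω (-(q + p))‖ₑ) ≤ 1 + M := by
    intro q
    have h := tsum_mul_sq_le (fun p => ‖ω p‖ₑ) (fun p => elen (q + p) * ‖ω (-(q + p))‖ₑ)
    have h3 : ∑' p, (elen (q + p) * ‖ω (-(q + p))‖ₑ) ^ 2 = ∑' k, (elen k * ‖ω k‖ₑ) ^ 2 := by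
      rw [← ((Equiv.addLeft q).trans (Equiv.neg _)).tsum_eq (fun k => (elen k * ‖ω k‖ₑ) ^ 2)]
      simp [elen, len_neg, -neg_add_rev]
    rw [h3] at h
    refine le_trans ?_ (add_le_add_right h 1)
    generalize (∑' p, ‖ω p‖ₑ * (elen (q + p) * ‖ω (-(q + p))‖ₑ)) = x
    rcases le_total x 1 with hx | hx
    · exact hx.trans le_self_add
    · exact (le_self_pow hx (by norm_num)).trans le_add_self
  refine ne_top_of_le_ne_top ?_ (ENNReal.tsum_le_tsum fun q => mul_le_mul_right (hb q) _)
  rw [ENNReal.tsum_mul_right]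
  exact ENNReal.mul_ne_top h1 (by finiteness)

include hω h1 h2 in
lemma summable_tri {θ : (Fin 2 → ℤ) → ℝ} (hθ : ∀ k ≠ 0, |θ k| ≤ 1) :
    Summable (triLeft θ ω) ∧ Summable (triMid θ ω) := by
  have hdom := tsum_dominant_ne_top hω h1 h2
  have key : ∀ (x : (Fin 2 → ℤ) × (Fin 2 → ℤ)) (r : ℝ), (x.1 ≠ 0 → x.2 ≠ 0 → x.1 + x.2 ≠ 0 →
      |r| ≤ (len x.1)⁻¹ * len (x.1 + x.2)) → (x.1 = 0 ∨ x.2 = 0 ∨ x.1 + x.2 = 0 → r = 0) →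
      ‖ω x.1 * ω x.2 * ω (-(x.1 + x.2)) * (r : ℂ)‖ₑ ≤ (‖ω x.1‖ₑ * ilen x.1) *
        (‖ω x.2‖ₑ * (elen (x.1 + x.2) * ‖ω (-(x.1 + x.2))‖ₑ)) := by
    intro x r hr hr0
    by_cases hx : x.1 = 0 ∨ x.2 = 0 ∨ x.1 + x.2 = 0
    · simp [hr0 hx]
    push Not at hx
    refine (enorm_mul_ofReal_le _ (hr hx.1 hx.2.1 hx.2.2)).trans_eq ?_
    rw [enorm_mul, enorm_mul, ENNReal.ofReal_mul (inv_nonneg.2 (len_nonneg _)), ilen, elen]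
    ring
  have hcross : ∀ q p : Fin 2 → ℤ, q = 0 ∨ p = 0 ∨ q + p = 0 → cross q p = 0 := by
    rintro q p (rfl | rfl | h)
    · simp [cross]
    · simp [cross]
    · rw [eq_neg_of_add_eq_zero_right h]; simp [cross]; ring
  refine ⟨summable_of_tsum_enorm_ne_top (ne_top_of_le_ne_top hdom (ENNReal.tsum_le_tsum
    fun x => key x _ (fun hq hp hn => ?_) fun hx => by rw [hcross _ _ hx]; simp)),
    summable_of_tsum_enorm_ne_top (ne_top_of_le_ne_top hdom (ENNReal.tsum_le_tsum
    fun x => key x _ (fun hq hp hn => ?_) fun hx => by rw [hcross _ _ hx]; simp))⟩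
  · have hq' := len_pos hq
    have h3 := abs_cross_le x.1 (x.1 + x.2)
    rw [cross_add_left] at h3
    calc |θ (x.1 + x.2) * (cross x.1 x.2 / lenSq x.1)|
        = |θ (x.1 + x.2)| * (|cross x.1 x.2| / lenSq x.1) := by
          rw [abs_mul, abs_div, abs_of_pos (lenSq_pos hq)]
      _ ≤ 1 * ((len x.1 * len (x.1 + x.2)) / lenSq x.1) := by
          have := lenSq_pos hq
          have := hθ _ hn
          gcongr
      _ = _ := by rw [← len_sq]; field_simp
  · have hq' := len_pos hq
    have hp' := len_pos hp
    have h3 := abs_cross_le (-(x.1 + x.2)) x.2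
    rw [cross_neg_add_left, abs_neg, len_neg] at h3
    have h4 := abs_dot_le x.1 x.2
    calc |θ (x.1 + x.2) * (cross x.1 x.2 * dot x.1 x.2 / (lenSq x.1 * lenSq x.2))|
        = |θ (x.1 + x.2)| * (|cross x.1 x.2| * |dot x.1 x.2| / (lenSq x.1 * lenSq x.2)) := by
          rw [abs_mul, abs_div, abs_mul, abs_of_pos (mul_pos (lenSq_pos hq) (lenSq_pos hp))]
      _ ≤ 1 * ((len (x.1 + x.2) * len x.2) * (len x.1 * len x.2) / (lenSq x.1 * lenSq x.2)) := by
          have := lenSq_pos hq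
          have := lenSq_pos hp
          have := hθ _ hn
          have := len_nonneg (x.1 + x.2)
          gcongr
      _ = _ := by rw [← len_sq, ← len_sq]; field_simp

include hω h1 h2 in
/-- The nonlinear term does not contribute to the balances of energy and of enstrophy. -/
lemma hasSum_nl (h0 : ω 0 = 0) {θ : (Fin 2 → ℤ) → ℝ}
    (hθ : θ = (fun _ => 1) ∨ θ = fun k => (lenSq k)⁻¹) :
    HasSum (fun k => θ k * (nl ω k * ω (-k))) 0 := by
  have hθ1 : ∀ k ≠ 0, |θ k| ≤ 1 := by
    rcases hθ with rfl | rfl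
    · simp
    · intro k hk
      rw [abs_of_pos (inv_pos.2 (lenSq_pos hk))]
      exact inv_le_one_of_one_le₀ (one_le_lenSq hk)
  obtain ⟨hsl, hsm⟩ := summable_tri hω h1 h2 hθ1
  have hl : ∑' x, triLeft θ ω x = 0 := by
    rcases hθ with rfl | rfl
    · exact tsum_triLeft_one
    · exact tsum_triLeft_inv
  have hF : HasSum (fun x : (Fin 2 → ℤ) × (Fin 2 → ℤ) =>
      (θ (x.1 + x.2) : ℂ) * (nlTerm ω x.1 x.2 * ω (-(x.1 + x.2)))) 0 := by
    have := hsl.hasSum.add hsm.hasSum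
    rw [hl, tsum_triMid, add_zero] at this
    simpa only [tri_split h0] using this
  let e : ((Fin 2 → ℤ) × (Fin 2 → ℤ)) ≃ ((Fin 2 → ℤ) × (Fin 2 → ℤ)) :=
    { toFun := fun x => (x.1 - x.2, x.2)
      invFun := fun x => (x.1 + x.2, x.2)
      left_inv := fun x => by simp
      right_inv := fun x => by simp }
  have hG := (e.hasSum_iff).2 hF
  refine hG.prod_fiberwise fun k => ?_
  have hk := (hG.summable.prod_factor k).hasSum
  simp only [e, Function.comp, Equiv.coe_fn_mk, sub_add_cancel] at hk ⊢
  rwa [tsum_mul_left, tsum_mul_right] at hk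

end cancellation

/-- The balances of energy (`θ = 1 / |k|²`) and enstrophy (`θ = 1`). -/
theorem hasSum_energy {ω ζ : (Fin 2 → ℤ) → ℂ} {c d : ℝ} (hc : 0 < c) (h0 : ω 0 = 0)
    (hneg : ∀ k, ω (-k) = -(starRingEnd ℂ) (ω k))
    (hω : ∑' k, ‖ω k‖ₑ ^ 2 ≠ ∞) (hζ : ∑' k, ‖ζ k‖ₑ ^ 2 ≠ ∞)
    (heq : ∀ k, ((1 + c * lenSq k : ℝ) : ℂ) * ω k + Complex.I * d * nl ω k = ζ k)
    {θ : (Fin 2 → ℤ) → ℝ} (hθ : θ = (fun _ => 1) ∨ θ = fun k => (lenSq k)⁻¹) :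
    HasSum (fun k => θ k * (((starRingEnd ℂ) (ω k) * ζ k).re - (1 + c * lenSq k) * ‖ω k‖ ^ 2))
      0 := by
  have h := (hasSum_nl hω (tsum_enorm_mul_ilen_ne_top hc hω hζ heq)
    (tsum_elen_mul_enorm_sq_ne_top hc hω hζ heq) h0 hθ).mul_left (-(Complex.I * d))
  rw [mul_zero] at h
  have h' := Complex.hasSum_re h
  rw [Complex.zero_re] at h'
  convert h' using 2 with k
  rw [hneg]
  have : ((starRingEnd ℂ) (ω k) * ζ k).re - (1 + c * lenSq k) * ‖ω k‖ ^ 2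
      = ((starRingEnd ℂ) (ω k) * (Complex.I * d * nl ω k)).re := by
    rw [← heq k, mul_add, Complex.add_re, mul_left_comm, Complex.conj_mul', Complex.re_ofReal_mul]
    norm_cast
    ring
  rw [this, ← Complex.re_ofReal_mul]
  congr 1
  ring

/-! ### Fourier coefficients of vector fields -/

/-- The Fourier coefficients of a vector field. -/
def vcoeff {L : ℝ} (u : W12 L) (i : Fin 2) (k : Fin 2 → ℤ) : ℂ := rcoeff (comp (toL2 L u) i) k

/-- The Fourier coefficients of the vorticity, up to the factor `2πi/L`. -/
def vort {L : ℝ} (u : W12 L) (k : Fin 2 → ℤ) : ℂ := ∑ i, (perp k i : ℂ) * vcoeff u i k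

lemma vcoeff_neg {L : ℝ} (u : W12 L) (i : Fin 2) (k : Fin 2 → ℤ) :
    vcoeff u i (-k) = (starRingEnd ℂ) (vcoeff u i k) := rcoeff_neg _ _

lemma vort_neg {L : ℝ} (u : W12 L) (k : Fin 2 → ℤ) :
    vort u (-k) = -(starRingEnd ℂ) (vort u k) := by
  simp [vort, vcoeff_neg, Fin.sum_univ_two, perp]
  ring

lemma vort_zero {L : ℝ} (u : W12 L) : vort u 0 = 0 := by
  simp [vort, Fin.sum_univ_two, perp]

lemma vcoeff_zero {L : ℝ} (u : W12 L) (i : Fin 2) : vcoeff u i 0 = 0 := by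
  have h : ∫ x in Dom L, comp (toL2 L u) i x * 1 = 0 := (toL2 L u).2 i
  rw [vcoeff, rcoeff, fcoeff_ofReal (Lsq_integrable _)]
  have hc : cosMode L 0 = fun _ => 1 := by ext x; simp [cosMode, phase]
  have hs : sinMode L 0 = fun _ => 0 := by ext x; simp [sinMode, phase]
  rw [hc, hs, h]
  simp

lemma rcoeff_grad {L : ℝ} (hL : 0 < L) (u : W12 L) (i j : Fin 2) (k : Fin 2 → ℤ) :
    rcoeff (entry (grad L u) i j) k = Complex.I * (2 * Real.pi / L * k j : ℝ) * vcoeff u i k :=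
  (hasWeakPartial_W12 u i j).rcoeff hL k

lemma sum_mul_vcoeff {L : ℝ} (hL : 0 < L) (u : V L) (k : Fin 2 → ℤ) :
    ∑ i, (k i : ℂ) * vcoeff (u : W12 L) i k = 0 := by
  have hc : (2 * Real.pi / L) ≠ 0 := by positivity
  have h1 := u.2 _ (isPeriodicTest_cosMode hL k)
  have h2 := u.2 _ (isPeriodicTest_sinMode hL k)
  change ∑ i, ∫ x in Dom L, comp (toL2 L (u : W12 L)) i x * _ = 0 at h1 h2
  simp only [pderiv_cosMode] at h1
  simp only [pderiv_sinMode] at h2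
  simp only [mul_left_comm _ (_ * ((k _ : ℤ) : ℝ)), mul_left_comm _ (-(_ * ((k _ : ℤ) : ℝ))),
    integral_const_mul, Fin.sum_univ_two] at h1 h2
  simp only [vcoeff, rcoeff, fcoeff_ofReal (Lsq_integrable _), Fin.sum_univ_two]
  generalize ∫ x in Dom L, comp (toL2 L (u : W12 L)) 0 x * sinMode L k x = s0 at *
  generalize ∫ x in Dom L, comp (toL2 L (u : W12 L)) 1 x * sinMode L k x = s1 at *
  generalize ∫ x in Dom L, comp (toL2 L (u : W12 L)) 0 x * cosMode L k x = c0 at *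
  generalize ∫ x in Dom L, comp (toL2 L (u : W12 L)) 1 x * cosMode L k x = c1 at *
  have h1' : (k 0 : ℝ) * s0 + k 1 * s1 = 0 := by
    refine (mul_eq_zero.1 (?_ : (2 * Real.pi / L) * _ = 0)).resolve_left hc
    linarith
  have h2' : (k 0 : ℝ) * c0 + k 1 * c1 = 0 := by
    refine (mul_eq_zero.1 (?_ : (2 * Real.pi / L) * _ = 0)).resolve_left hc
    linarith
  have h1'' : (k 0 : ℂ) * s0 + k 1 * s1 = 0 := by exact_mod_cast h1'
  have h2'' : (k 0 : ℂ) * c0 + k 1 * c1 = 0 := by exact_mod_cast h2'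
  linear_combination (((L ^ 2)⁻¹ : ℝ) : ℂ) * h2'' - (((L ^ 2)⁻¹ : ℝ) : ℂ) * Complex.I * h1''

/-- A divergence-free field is determined by its vorticity. -/
lemma vcoeff_eq {L : ℝ} (hL : 0 < L) (u : V L) (i : Fin 2) (k : Fin 2 → ℤ) :
    vcoeff (u : W12 L) i k = vort (u : W12 L) k * (perp k i / lenSq k : ℝ) := by
  rcases eq_or_ne k 0 with rfl | hk
  · rw [vcoeff_zero, vort_zero, zero_mul]
  have h := sum_mul_vcoeff hL u k
  have h1 : ((k 0 : ℂ) ^ 2 + (k 1 : ℂ) ^ 2) ≠ 0 := by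
    have := (lenSq_pos hk).ne'
    unfold lenSq at this
    exact_mod_cast this
  rw [Fin.sum_univ_two] at h
  fin_cases i
  · simp [vort, perp, lenSq]
    field_simp
    linear_combination (k 0 : ℂ) * h
  · simp [vort, perp, lenSq]
    field_simp
    linear_combination (k 1 : ℂ) * h

lemma hasSum_inner_toL2 {L : ℝ} (hL : 0 < L) (u v : W12 L) :
    HasSum (fun k => ∑ i, (starRingEnd ℂ) (vcoeff u i k) * vcoeff v i k)
      (((L ^ 2)⁻¹ * inner ℝ (toL2 L u) (toL2 L v) : ℝ) : ℂ) := by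
  have h := hasSum_sum (s := Finset.univ) fun (i : Fin 2) _ =>
    hasSum_rcoeff hL (comp (toL2 L u) i) (comp (toL2 L v) i)
  rw [inner_L2v, Finset.mul_sum, Complex.ofReal_sum]
  exact h

lemma hasSum_inner_grad {L : ℝ} (hL : 0 < L) (u v : W12 L) :
    HasSum (fun k => ((2 * Real.pi / L) ^ 2 * lenSq k : ℝ) *
        ∑ i, (starRingEnd ℂ) (vcoeff u i k) * vcoeff v i k)
      (((L ^ 2)⁻¹ * inner ℝ (grad L u) (grad L v) : ℝ) : ℂ) := by
  have h := hasSum_sum (s := Finset.univ) fun (i : Fin 2) _ =>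
    hasSum_sum (s := Finset.univ) fun (j : Fin 2) _ =>
    hasSum_rcoeff hL (entry (grad L u) i j) (entry (grad L v) i j)
  simp only [inner_L2t, Finset.mul_sum, Complex.ofReal_sum]
  convert h using 2 with k
  simp only [rcoeff_grad hL, Fin.sum_univ_two, lenSq, map_mul, Complex.conj_I, Complex.conj_ofReal]
  push_cast
  linear_combination ((2 * Real.pi / L : ℂ) ^ 2 * ((k 0 : ℂ) ^ 2 + (k 1 : ℂ) ^ 2) *
    ((starRingEnd ℂ) (vcoeff u 0 k) * vcoeff v 0 k
      + (starRingEnd ℂ) (vcoeff u 1 k) * vcoeff v 1 k)) * Complex.I_sq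

lemma tsum_vort_sq_ne_top {L : ℝ} (hL : 0 < L) (z : W12 L) : ∑' k, ‖vort z k‖ₑ ^ 2 ≠ ∞ := by
  have hκ : 0 < (2 * Real.pi / L) ^ 2 := by positivity
  have h := (Complex.hasSum_re (hasSum_inner_grad hL z z)).summable
  have hs : Summable fun k => ‖vort z k‖ ^ 2 := by
    refine Summable.of_nonneg_of_le (fun k => by positivity) (fun k => ?_)
      (h.mul_left ((2 * Real.pi / L) ^ 2)⁻¹)
    rw [Complex.re_ofReal_mul, Complex.re_sum]
    simp only [Complex.conj_mul']
    norm_cast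
    rw [← mul_assoc, ← mul_assoc, inv_mul_cancel₀ hκ.ne', one_mul, Fin.sum_univ_two]
    have h1 : ‖vort z k‖ ≤ |(k 1 : ℝ)| * ‖vcoeff z 0 k‖ + |(k 0 : ℝ)| * ‖vcoeff z 1 k‖ := by
      rw [vort, Fin.sum_univ_two]
      refine (norm_add_le _ _).trans_eq ?_
      simp [perp]
    refine (pow_le_pow_left₀ (norm_nonneg _) h1 2).trans ?_
    rw [lenSq, ← sq_abs (k 0 : ℝ), ← sq_abs (k 1 : ℝ)]
    nlinarith [sq_nonneg (|(k 1 : ℝ)| * ‖vcoeff z 1 k‖ - |(k 0 : ℝ)| * ‖vcoeff z 0 k‖)]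
  have := hs.tsum_ofReal_ne_top
  simpa only [ENNReal.ofReal_pow (norm_nonneg _), ofReal_norm] using this

/-- The inner product of `𝕎^{1,2}` in terms of vorticity. -/
lemma hasSum_inner_W12 {L : ℝ} (hL : 0 < L) (u : V L) (z : W12 L) :
    HasSum (fun k => ((lenSq k)⁻¹ + (2 * Real.pi / L) ^ 2) *
      ((starRingEnd ℂ) (vort (u : W12 L) k) * vort z k).re)
      ((L ^ 2)⁻¹ * inner ℝ (u : W12 L) z) := by
  have h := Complex.hasSum_re ((hasSum_inner_toL2 hL u z).add (hasSum_inner_grad hL u z))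
  have hv : ((((L ^ 2)⁻¹ * inner ℝ (toL2 L (u : W12 L)) (toL2 L z) : ℝ) : ℂ)
      + (((L ^ 2)⁻¹ * inner ℝ (grad L (u : W12 L)) (grad L z) : ℝ) : ℂ)).re
      = (L ^ 2)⁻¹ * inner ℝ (u : W12 L) z := by
    rw [← Complex.ofReal_add, Complex.ofReal_re, inner_W12]; ring
  rw [hv] at h
  convert h using 2 with k
  have hsum : ∑ i, (starRingEnd ℂ) (vcoeff (u : W12 L) i k) * vcoeff z i k
      = ((lenSq k)⁻¹ : ℝ) * ((starRingEnd ℂ) (vort (u : W12 L) k) * vort z k) := by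
    simp only [vcoeff_eq hL u, map_mul, Complex.conj_ofReal, Fin.sum_univ_two]
    rw [vort.eq_1 z, Fin.sum_univ_two]
    push_cast
    ring
  rw [hsum, Complex.add_re, Complex.re_ofReal_mul, Complex.re_ofReal_mul, Complex.re_ofReal_mul]
  rcases eq_or_ne k 0 with rfl | hk
  · simp [vort_zero]
  · have := (lenSq_pos hk).ne'
    field_simp

lemma nl_vort {L : ℝ} (hL : 0 < L) (u : V L) (k : Fin 2 → ℤ) :
    ∑ i, (perp k i : ℂ) * ∑ j, fcoeff L (fun x =>
      (comp (toL2 L (u : W12 L)) j x * entry (grad L (u : W12 L)) i j x : ℝ)) k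
      = Complex.I * (2 * Real.pi / L : ℝ) * nl (vort (u : W12 L)) k := by
  have h := hasSum_sum (s := Finset.univ) fun (i : Fin 2) _ =>
    (hasSum_sum (s := Finset.univ) fun (j : Fin 2) _ => hasSum_convolution hL
      (comp (toL2 L (u : W12 L)) j) (entry (grad L (u : W12 L)) i j) k).mul_left (perp k i : ℂ)
  rw [nl, ← tsum_mul_left, ← h.tsum_eq]
  refine tsum_congr fun p => ?_
  obtain ⟨q, rfl⟩ : ∃ q, k = q + p := ⟨k - p, by abel⟩
  have hv : ∀ j, rcoeff (comp (toL2 L (u : W12 L)) j) q = vcoeff (u : W12 L) j q := fun _ => rfl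
  simp only [add_sub_cancel_right, rcoeff_grad hL, hv, vcoeff_eq hL u, nlTerm, Fin.sum_univ_two,
    cross, dot, perp, Pi.add_apply]
  simp
  ring

/-- The a priori estimate for one implicit step. -/
theorem norm_sq_le_inner {L : ℝ} (hL : 0 < L) (u : V L) (z : W12 L) {h ν : ℝ} (hh : 0 < h)
    (hν : 0 < ν)
    (heq : ∀ φ : V L, inner ℝ (toL2 L (u : W12 L) - toL2 L z) (toL2 L φ)
      + h * (ν * inner ℝ (grad L (u : W12 L)) (grad L φ) + trilin (u : W12 L) u φ) = 0) :
    (1 + h * ν * (2 * Real.pi / L) ^ 2) * ‖u‖ ^ 2 ≤ inner ℝ (u : W12 L) z := by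
  set κ := 2 * Real.pi / L with hκ
  have hκ0 : 0 < κ := by positivity
  have hc : 0 < h * ν * κ ^ 2 := by positivity
  have heq' : ∀ k, ((1 + h * ν * κ ^ 2 * lenSq k : ℝ) : ℂ) * vort (u : W12 L) k
      + Complex.I * (h * κ : ℝ) * nl (vort (u : W12 L)) k = vort z k := by
    intro k
    rcases eq_or_ne k 0 with rfl | hk
    · have : nl (vort (u : W12 L)) 0 = 0 := by
        refine (tsum_congr fun p => ?_).trans tsum_zero
        simp [nlTerm, dot]
      simp [vort_zero, this]
    have h1 := fourier_equation hL (u : W12 L) z h ν heq hk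
    have h2 := nl_vort hL u k
    rw [vort.eq_1 z, vort.eq_1 (u : W12 L)]
    rw [Fin.sum_univ_two] at h1 h2 ⊢
    rw [Fin.sum_univ_two]
    simp only [vcoeff, hκ]
    push_cast at h1 h2 ⊢
    linear_combination h1 - h * h2
  have hω := tsum_vort_sq_ne_top hL (u : W12 L)
  have hζ := tsum_vort_sq_ne_top hL z
  have e1 := hasSum_energy hc (vort_zero _) (vort_neg _) hω hζ heq' (Or.inr rfl)
  have e2 := (hasSum_energy hc (vort_zero _) (vort_neg _) hω hζ heq' (Or.inl rfl)).mul_left (κ ^ 2)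
  have e3 := (hasSum_inner_W12 hL u z).sub
    ((hasSum_inner_W12 hL u (u : W12 L)).mul_left (1 + h * ν * κ ^ 2))
  have hle := hasSum_le (fun k => ?_) (e1.add e2) e3
  · have hL2 : 0 < (L ^ 2)⁻¹ := by positivity
    rw [mul_zero, add_zero, real_inner_self_eq_norm_sq, mul_left_comm, ← mul_sub] at hle
    have := (mul_nonneg_iff_of_pos_left hL2).1 hle
    rw [Submodule.coe_norm]
    linarith
  · rw [Complex.conj_mul', ← hκ]
    norm_cast
    rcases eq_or_ne k 0 with rfl | hk
    · simp [vort_zero]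
    have h1 := one_le_lenSq hk
    have h2 : 0 ≤ (lenSq k)⁻¹ := inv_nonneg.2 (lenSq_nonneg k)
    have h3 : 0 ≤ ((lenSq k)⁻¹ + κ ^ 2) * (h * ν * κ ^ 2 * (lenSq k - 1)
        * ‖vort (u : W12 L) k‖ ^ 2) := by
      have : 0 ≤ lenSq k - 1 := by linarith
      positivity
    linarith

theorem norm_sq_le_norm_sq {L : ℝ} (hL : 0 < L) (u : V L) (z : W12 L) {h ν : ℝ} (hh : 0 < h)
    (hν : 0 < ν)
    (heq : ∀ φ : V L, inner ℝ (toL2 L (u : W12 L) - toL2 L z) (toL2 L φ)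
      + h * (ν * inner ℝ (grad L (u : W12 L)) (grad L φ) + trilin (u : W12 L) u φ) = 0) :
    (1 + 2 * (h * ν * (2 * Real.pi / L) ^ 2)) * ‖u‖ ^ 2 ≤ ‖z‖ ^ 2 := by
  have h1 := norm_sq_le_inner hL u z hh hν heq
  have h2 := norm_sub_sq_real (u : W12 L) z
  have h3 : ‖(u : W12 L)‖ = ‖u‖ := rfl
  rw [h3] at h2
  nlinarith [sq_nonneg ‖(u : W12 L) - z‖]

/-! ### The constant in the Poincaré inequality -/

lemma integral_cosMode_sq_pos {L : ℝ} (hL : 0 < L) {k : Fin 2 → ℤ} (hk : k ≠ 0) :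
    0 < ∫ x in Dom L, cosMode L k x * cosMode L k x := by
  obtain ⟨j, hj⟩ := Function.ne_iff.1 hk
  have hc : 2 * Real.pi / L * k j ≠ 0 := by
    have : (k j : ℝ) ≠ 0 := by exact_mod_cast hj
    positivity
  have hcos := isPeriodicTest_cosMode hL k
  have hsin := isPeriodicTest_sinMode hL k
  have h := integral_mul_pderiv hL hsin hcos j
  rw [pderiv_cosMode, pderiv_sinMode] at h
  simp only [mul_left_comm _ (_ * (k j : ℝ)), integral_const_mul, neg_mul,
    integral_neg, neg_neg] at h
  simp only [mul_assoc, integral_const_mul] at h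
  simp only [← mul_assoc] at h
  have h' := mul_left_cancel₀ hc h
  have h1 : ∫ x in Dom L, (cosMode L k x * cosMode L k x + sinMode L k x * sinMode L k x)
      = L ^ 2 := by
    have : ∀ x, cosMode L k x * cosMode L k x + sinMode L k x * sinMode L k x = 1 := fun x => by
      rw [← sq, ← sq]; exact Real.cos_sq_add_sin_sq _
    simp only [this]
    simp [Dom, Measure.real, Real.volume_Icc_pi, hL.le]
  have i1 : Integrable (fun x => cosMode L k x * cosMode L k x) (volume.restrict (Dom L)) :=
    integrable_Dom (hcos.continuous.mul hcos.continuous)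
  have i2 : Integrable (fun x => sinMode L k x * sinMode L k x) (volume.restrict (Dom L)) :=
    integrable_Dom (hsin.continuous.mul hsin.continuous)
  rw [integral_add i1 i2, ← h'] at h1
  nlinarith [pow_pos hL 2]

/-- The constant in `|∇u|² ≤ C |Au|²` is at least `(L / 2π)²`. -/
theorem one_le_const_mul {L : ℝ} (hL : 0 < L) {Ct : ℝ}
    (hCt : ∀ w : DomA L, ‖grad L w.u‖ ^ 2 ≤ Ct * ‖w.A‖ ^ 2) :
    1 ≤ Ct * (2 * Real.pi / L) ^ 2 := by
  set κ := 2 * Real.pi / L with hκ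
  have hκ0 : 0 < κ := by positivity
  let k : Fin 2 → ℤ := ![1, 0]
  have hk : k ≠ 0 := fun h => by simpa [k] using congrFun h 0
  have hcos := isPeriodicTest_cosMode hL k
  have hd : ∀ j, IsPeriodicTest L (pderiv j (cosMode L k)) := fun j => by
    rw [pderiv_cosMode]; exact (isPeriodicTest_sinMode hL k).const_mul _
  have hdd : ∀ j l, pderiv l (pderiv j (cosMode L k))
      = fun x => -(κ * k j) * (κ * k l) * cosMode L k x := fun j l => by
    rw [pderiv_cosMode, pderiv_const_mul _ (isPeriodicTest_sinMode hL k), pderiv_sinMode]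
    ext x; ring
  have ha : ∀ x, ∑ i, perp k i * pderiv i (cosMode L k) x = 0 := fun x => by
    simp [pderiv_cosMode, Fin.sum_univ_two, perp, k]
  have h0 := (integral_modes_eq_zero hL hk).1
  let v : V L := wave hL hcos (perp k) ha h0
  let w : DomA L :=
    { u := v
      hess := fun i j l => perp k i • ofCont L (pderiv l (pderiv j (cosMode L k)))
        ((hd j).continuous_pderiv l)
      hasWeakPartial := fun i j l => (hasWeakPartial_ofCont hL (hd j) l).smul (perp k i) }
  have hA : w.A = κ ^ 2 • ((show meanZero L from toL2 L (v : W12 L)) : PiLp 2 fun _ : Fin 2 => Lsq L) := by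
    ext i : 1
    change -∑ j, perp k i • ofCont L (pderiv j (pderiv j (cosMode L k)))
        ((hd j).continuous_pderiv j) = κ ^ 2 • (perp k i • ofCont L (cosMode L k) hcos.continuous)
    have h00 : ofCont L (pderiv 0 (pderiv 0 (cosMode L k))) ((hd 0).continuous_pderiv 0)
        = (-κ ^ 2) • ofCont L (cosMode L k) hcos.continuous := by
      refine Lp.ext ?_
      filter_upwards [coeFn_ofCont L ((hd 0).continuous_pderiv 0), coeFn_ofCont L hcos.continuous,
        Lp.coeFn_smul (-κ ^ 2) (ofCont L (cosMode L k) hcos.continuous)] with x h1 h2 h3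
      have hk0 : k 0 = 1 := rfl
      rw [h1, h3, Pi.smul_apply, h2, hdd, hk0, smul_eq_mul]
      push_cast; ring
    have h11 : ofCont L (pderiv 1 (pderiv 1 (cosMode L k))) ((hd 1).continuous_pderiv 1) = 0 := by
      refine Lp.ext ?_
      filter_upwards [coeFn_ofCont L ((hd 1).continuous_pderiv 1),
        Lp.coeFn_zero ℝ 2 (volume.restrict (Dom L))] with x h1 h2
      rw [h1, h2, hdd]
      simp [k]
    rw [Fin.sum_univ_two, h00, h11]
    module
  have hX : inner ℝ (toL2 L (v : W12 L)) (toL2 L (v : W12 L))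
      = ∫ x in Dom L, cosMode L k x * cosMode L k x := by
    simp only [v, inner_wave, comp_wave, integral_smul_mul, integral_ofCont_mul, Fin.sum_univ_two]
    simp [perp, k]
  have hgrad : ‖grad L (v : W12 L)‖ ^ 2 = κ ^ 2 * ‖toL2 L (v : W12 L)‖ ^ 2 := by
    rw [← real_inner_self_eq_norm_sq, ← real_inner_self_eq_norm_sq]
    have := inner_grad_wave hL hcos (perp k) ha h0 (v : W12 L) hd (c := κ ^ 2) (fun x => by
      have hk0 : k 0 = 1 := rfl
      have hk1 : k 1 = 0 := rfl
      rw [Fin.sum_univ_two, hdd, hdd, hk0, hk1]; push_cast; ring)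
    rw [← inner_wave hL hcos (perp k) ha h0] at this
    exact this
  have hXpos : 0 < ‖toL2 L (v : W12 L)‖ ^ 2 := by
    rw [← real_inner_self_eq_norm_sq, hX]
    exact integral_cosMode_sq_pos hL hk
  have h := hCt w
  rw [hA, norm_smul, mul_pow] at h
  change ‖grad L (v : W12 L)‖ ^ 2 ≤ Ct * (‖κ ^ 2‖ ^ 2 * ‖toL2 L (v : W12 L)‖ ^ 2) at h
  rw [hgrad, Real.norm_eq_abs, sq_abs] at h
  have h2 : (κ ^ 2 * ‖toL2 L (v : W12 L)‖ ^ 2) * 1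
      ≤ (κ ^ 2 * ‖toL2 L (v : W12 L)‖ ^ 2) * (Ct * κ ^ 2) := by linarith
  exact le_of_mul_le_mul_left h2 (by positivity)

/-! ### Trace-class operators -/

section hilbert

variable {K : Type*} [NormedAddCommGroup K] [InnerProductSpace ℝ K]

lemma inner_sq_le_of_isPositive {Q : K →L[ℝ] K} (hQ : Q.IsPositive) (x y : K) :
    inner ℝ (Q x) y ^ 2 ≤ inner ℝ (Q x) x * inner ℝ (Q y) y := by
  have h : ∀ t : ℝ, 0 ≤ inner ℝ (Q y) y * (t * t) + (2 * inner ℝ (Q x) y) * t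
      + inner ℝ (Q x) x := by
    intro t
    have h1 := hQ.inner_nonneg_left (x + t • y)
    have h2 : inner ℝ (Q y) x = inner ℝ (Q x) y := by
      rw [real_inner_comm]; exact (hQ.isSymmetric x y).symm
    simp only [map_add, map_smul, inner_add_left, inner_add_right, inner_smul_left,
      inner_smul_right, h2, RCLike.conj_to_real] at h1
    linarith
  have := discrim_le_zero h
  rw [discrim] at this
  linarith

lemma hasSum_inner_sq {ι : Type*} (e : HilbertBasis ι ℝ K) (x : K) :
    HasSum (fun j => inner ℝ x (e j) ^ 2) (‖x‖ ^ 2) := by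
  have h := e.hasSum_inner_mul_inner x x
  rw [real_inner_self_eq_norm_sq] at h
  have h1 : ∀ j, inner ℝ x (e j) * inner ℝ (e j) x = inner ℝ x (e j) ^ 2 := fun j => by
    rw [real_inner_comm x (e j), sq]
  simpa only [h1] using h

lemma inner_le_trace {Q : K →L[ℝ] K} (hQ : Q.IsPositive) {ι : Type*} (e : HilbertBasis ι ℝ K)
    (hQtr : Summable fun j => inner ℝ (Q (e j)) (e j)) (x : K) :
    inner ℝ (Q x) x ≤ trace e Q * ‖x‖ ^ 2 := by
  have h1 := hasSum_inner_sq e (Q x)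
  have h2 : ‖Q x‖ ^ 2 ≤ inner ℝ (Q x) x * trace e Q :=
    hasSum_le (fun j => inner_sq_le_of_isPositive hQ x (e j)) h1
      (hQtr.hasSum.mul_left _)
  have h3 : inner ℝ (Q x) x ≤ ‖Q x‖ * ‖x‖ := real_inner_le_norm _ _
  have h4 : 0 ≤ trace e Q := tsum_nonneg fun j => hQ.inner_nonneg_left (e j)
  have h5 := hQ.inner_nonneg_left x
  have h6 : ‖Q x‖ ≤ trace e Q * ‖x‖ := by
    rcases (norm_nonneg (Q x)).eq_or_lt with h | h
    · rw [← h]; positivity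
    · refine le_of_mul_le_mul_left ?_ h
      nlinarith [mul_le_mul_of_nonneg_right h3 h4]
  calc inner ℝ (Q x) x ≤ ‖Q x‖ * ‖x‖ := h3
    _ ≤ (trace e Q * ‖x‖) * ‖x‖ := by gcongr
    _ = _ := by ring

lemma trace_nonneg {Q : K →L[ℝ] K} (hQ : Q.IsPositive) {ι : Type*} (e : HilbertBasis ι ℝ K) :
    0 ≤ trace e Q := tsum_nonneg fun j => hQ.inner_nonneg_left (e j)

lemma countable_of_orthonormal [TopologicalSpace.SeparableSpace K] {ι : Type*} {e : ι → K}
    (he : Orthonormal ℝ e) : Countable ι := by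
  refine Pairwise.countable_of_isOpen_disjoint (s := fun i => Metric.ball (e i) (1 / 2)) ?_
    (fun i => Metric.isOpen_ball) (fun i => ⟨e i, Metric.mem_ball_self (by norm_num)⟩)
  intro i j hij
  refine Metric.ball_disjoint_ball ?_
  have h : ‖e i - e j‖ ^ 2 = 2 := by
    rw [norm_sub_sq_real, he.1, he.1, he.2 hij]; norm_num
  rw [dist_eq_norm]
  nlinarith [norm_nonneg (e i - e j)]

end hilbert

/-! ### Exponential moments of Gaussian variables -/

lemma lintegral_exp_mul_gaussianReal (v : ℝ≥0) (t : ℝ) :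
    ∫⁻ x, ENNReal.ofReal (Real.exp (t * x)) ∂gaussianReal 0 v
      = ENNReal.ofReal (Real.exp (v * t ^ 2 / 2)) := by
  rw [← ofReal_integral_eq_lintegral_ofReal (integrable_exp_mul_gaussianReal t)
    (.of_forall fun x => (Real.exp_pos _).le)]
  congr 1
  have := congrFun (mgf_fun_id_gaussianReal (μ := 0) (v := v)) t
  simpa [mgf] using this

lemma lintegral_exp_sq_gaussianReal_le {v : ℝ≥0} {c : ℝ} (hc : 0 ≤ c) (hcv : 4 * c * v ≤ 1) :
    ∫⁻ x, ENNReal.ofReal (Real.exp (c * x ^ 2)) ∂gaussianReal 0 v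
      ≤ ENNReal.ofReal (Real.exp (2 * c * v)) := by
  rcases eq_or_ne v 0 with rfl | hv
  · rw [gaussianReal_zero_var, lintegral_dirac' _ (by fun_prop)]; simp
  have hv0 : (0 : ℝ) < v := by positivity
  set b : ℝ := 1 / (2 * v) - c with hb
  have hb0 : 0 < b := by
    rw [hb, sub_pos, lt_div_iff₀ (by positivity)]; linarith
  rw [gaussianReal_of_var_ne_zero _ hv,
    lintegral_withDensity_eq_lintegral_mul _ (by fun_prop) (by fun_prop)]
  have h1 : ∀ x : ℝ, (gaussianPDF 0 v * fun x => ENNReal.ofReal (Real.exp (c * x ^ 2))) x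
      = ENNReal.ofReal ((√(2 * Real.pi * v))⁻¹ * Real.exp (-b * x ^ 2)) := by
    intro x
    rw [Pi.mul_apply, gaussianPDF, ← ENNReal.ofReal_mul (gaussianPDFReal_nonneg _ _ _),
      gaussianPDFReal, mul_assoc, ← Real.exp_add]
    congr 3
    rw [hb]
    field_simp
    ring
  simp_rw [h1]
  rw [← ofReal_integral_eq_lintegral_ofReal ((integrable_exp_neg_mul_sq hb0).const_mul _)
    (.of_forall fun x => by positivity), integral_const_mul, integral_gaussian]
  refine ENNReal.ofReal_le_ofReal ?_
  have hy : 0 < 1 - 2 * c * v := by linarith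
  have h2 : (√(2 * Real.pi * v))⁻¹ * √(Real.pi / b) = √(1 / (1 - 2 * c * v)) := by
    rw [← Real.sqrt_inv, ← Real.sqrt_mul (by positivity)]
    congr 1
    have hpi := Real.pi_pos
    have hbv : 2 * v * b = 1 - 2 * c * v := by rw [hb]; field_simp
    rw [← hbv]
    field_simp
  rw [h2]
  refine Real.sqrt_le_iff.2 ⟨(Real.exp_pos _).le, ?_⟩
  rw [div_le_iff₀ hy, ← Real.exp_nat_mul]
  have h3 := Real.add_one_le_exp (((2 : ℕ) : ℝ) * (2 * c * v))
  push_cast at h3 ⊢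
  have h4 : 0 ≤ 2 * c * v := by positivity
  calc (1 : ℝ) ≤ (2 * (2 * c * v) + 1) * (1 - 2 * c * v) := by nlinarith
    _ ≤ _ := by gcongr

/-! ### Exponential moments of Gaussian vectors -/

section gaussian

variable {Ω : Type*} {mΩ : MeasurableSpace Ω} {P : Measure Ω} [IsProbabilityMeasure P]
  {K : Type*} [NormedAddCommGroup K] [InnerProductSpace ℝ K] [MeasurableSpace K] [BorelSpace K]
  {Q : K →L[ℝ] K} {ι : Type*} {e : HilbertBasis ι ℝ K} {ξ : Ω → K} {h : ℝ}

omit [IsProbabilityMeasure P] in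
lemma lintegral_comp_inner (hξ : Measurable ξ) (x : K) {v : ℝ≥0}
    (hx : P.map (fun ω => inner ℝ (ξ ω) x) = gaussianReal 0 v) {F : ℝ → ℝ≥0∞}
    (hF : Measurable F) :
    ∫⁻ ω, F (inner ℝ (ξ ω) x) ∂P = ∫⁻ t, F t ∂gaussianReal 0 v := by
  have hm : Measurable fun ω => inner ℝ (ξ ω) x :=
    (continuous_id.inner continuous_const).measurable.comp hξ
  rw [← hx, lintegral_map hF hm]

omit [IsProbabilityMeasure P] in
lemma lintegral_exp_inner (hQ : Q.IsPositive) (hh : 0 ≤ h) (hξ : Measurable ξ)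
    (hgauss : ∀ x, P.map (fun ω => inner ℝ (ξ ω) x) = gaussianReal 0 (h * inner ℝ (Q x) x).toNNReal)
    (x : K) (t : ℝ) :
    ∫⁻ ω, ENNReal.ofReal (Real.exp (t * inner ℝ (ξ ω) x)) ∂P
      = ENNReal.ofReal (Real.exp (h * inner ℝ (Q x) x * t ^ 2 / 2)) := by
  rw [lintegral_comp_inner hξ x (hgauss x)
    (F := fun s => ENNReal.ofReal (Real.exp (t * s))) (by fun_prop),
    lintegral_exp_mul_gaussianReal,
    Real.coe_toNNReal _ (mul_nonneg hh (hQ.inner_nonneg_left x))]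

lemma exp_sum_mul_le {s : Finset ι} {p y : ι → ℝ} (hp : ∀ j, 0 ≤ p j) (hs : ∑ j ∈ s, p j ≤ 1) :
    Real.exp (∑ j ∈ s, p j * y j) ≤ ∑ j ∈ s, p j * Real.exp (y j) + (1 - ∑ j ∈ s, p j) := by
  have := convexOn_exp.map_add_sum_le (t := s) (w := p) (p := y) (v := 1 - ∑ j ∈ s, p j) (q := 0)
    (fun j _ => hp j) (by ring) (fun _ _ => Set.mem_univ _) (by linarith) (Set.mem_univ _)
  simp only [smul_eq_mul, mul_zero, zero_add, Real.exp_zero, mul_one] at this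
  linarith

lemma lintegral_exp_sum_sq_le (hQ : Q.IsPositive)
    (hQtr : Summable fun j => inner ℝ (Q (e j)) (e j)) (hh : 0 ≤ h) (hξ : Measurable ξ)
    (hgauss : ∀ x, P.map (fun ω => inner ℝ (ξ ω) x) = gaussianReal 0 (h * inner ℝ (Q x) x).toNNReal)
    {c : ℝ} (hc : 0 ≤ c) (hch : 4 * c * (h * trace e Q) ≤ 1) (s : Finset ι) :
    ∫⁻ ω, ENNReal.ofReal (Real.exp (c * ∑ j ∈ s, inner ℝ (ξ ω) (e j) ^ 2)) ∂P
      ≤ ENNReal.ofReal (Real.exp (2 * c * (h * trace e Q))) := by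
  have hq : ∀ j, 0 ≤ inner ℝ (Q (e j)) (e j) := fun j => hQ.inner_nonneg_left (e j)
  have htr : 0 ≤ trace e Q := trace_nonneg hQ e
  have hle : ∀ j, inner ℝ (Q (e j)) (e j) ≤ trace e Q := fun j => hQtr.le_tsum j fun i _ => hq i
  set p : ι → ℝ := fun j => inner ℝ (Q (e j)) (e j) / trace e Q with hp
  have hp0 : ∀ j, 0 ≤ p j := fun j => div_nonneg (hq j) htr
  have hps : ∑ j ∈ s, p j ≤ 1 := by
    rw [← Finset.sum_div]
    exact div_le_one_of_le₀ (hQtr.sum_le_tsum s fun i _ => hq i) htr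
  have hE : 1 ≤ Real.exp (2 * c * (h * trace e Q)) := Real.one_le_exp (by positivity)
  have hmeas : ∀ j, Measurable fun ω => inner ℝ (ξ ω) (e j) := fun j =>
    (continuous_id.inner continuous_const).measurable.comp hξ
  have hzero : ∀ j, p j = 0 → ∀ᵐ ω ∂P, inner ℝ (ξ ω) (e j) = 0 := by
    intro j hj
    have hqj : inner ℝ (Q (e j)) (e j) = 0 := by
      rcases div_eq_zero_iff.1 hj with h0 | h0
      · exact h0
      · exact le_antisymm (h0 ▸ hle j) (hq j)
    have hlaw := hgauss (e j)
    rw [hqj, mul_zero, Real.toNNReal_zero, gaussianReal_zero_var] at hlaw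
    have : ∀ᵐ t ∂(P.map fun ω => inner ℝ (ξ ω) (e j)), t = 0 := by
      rw [hlaw, ae_dirac_eq]
      exact rfl
    exact ae_of_ae_map (hmeas j).aemeasurable this
  have hae : ∀ᵐ ω ∂P, ∀ j ∈ s, p j = 0 → inner ℝ (ξ ω) (e j) = 0 := by
    rw [Filter.eventually_all_finset]
    intro j _
    by_cases hj : p j = 0
    · filter_upwards [hzero j hj] with ω hω _ using hω
    · exact .of_forall fun ω h0 => absurd h0 hj
  have hmom : ∀ j, ENNReal.ofReal (p j) *
      ∫⁻ ω, ENNReal.ofReal (Real.exp (c / p j * inner ℝ (ξ ω) (e j) ^ 2)) ∂P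
      ≤ ENNReal.ofReal (p j) * ENNReal.ofReal (Real.exp (2 * c * (h * trace e Q))) := by
    intro j
    by_cases hj : p j = 0
    · simp [hj]
    have htr0 : trace e Q ≠ 0 := fun h0 => hj (by simp [hp, h0])
    have hq0 : inner ℝ (Q (e j)) (e j) ≠ 0 := fun h0 => hj (by simp [hp, h0])
    have hval : c / p j * (h * inner ℝ (Q (e j)) (e j)) = c * (h * trace e Q) := by
      simp only [hp]; field_simp
    gcongr
    rw [lintegral_comp_inner hξ (e j) (hgauss (e j))
      (F := fun t => ENNReal.ofReal (Real.exp (c / p j * t ^ 2))) (by fun_prop)]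
    have hcoe : (((h * inner ℝ (Q (e j)) (e j)).toNNReal : ℝ≥0) : ℝ)
        = h * inner ℝ (Q (e j)) (e j) := Real.coe_toNNReal _ (mul_nonneg hh (hq j))
    refine (lintegral_exp_sq_gaussianReal_le (div_nonneg hc (hp0 j)) ?_).trans_eq ?_
    · rw [hcoe, mul_assoc, hval]; linarith
    · rw [hcoe, mul_assoc, hval, mul_assoc]
  calc ∫⁻ ω, ENNReal.ofReal (Real.exp (c * ∑ j ∈ s, inner ℝ (ξ ω) (e j) ^ 2)) ∂P
      ≤ ∫⁻ ω, (∑ j ∈ s, ENNReal.ofReal (p j) *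
          ENNReal.ofReal (Real.exp (c / p j * inner ℝ (ξ ω) (e j) ^ 2))
          + ENNReal.ofReal (1 - ∑ j ∈ s, p j)) ∂P := by
        refine lintegral_mono_ae ?_
        filter_upwards [hae] with ω hω
        have h1 : c * ∑ j ∈ s, inner ℝ (ξ ω) (e j) ^ 2
            = ∑ j ∈ s, p j * (c / p j * inner ℝ (ξ ω) (e j) ^ 2) := by
          rw [Finset.mul_sum]
          refine Finset.sum_congr rfl fun j hj => ?_
          by_cases hpj : p j = 0
          · simp [hω j hj hpj]
          · field_simp
        rw [h1]
        refine (ENNReal.ofReal_le_ofReal (exp_sum_mul_le hp0 hps)).trans_eq ?_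
        rw [ENNReal.ofReal_add (Finset.sum_nonneg fun j _ =>
          mul_nonneg (hp0 j) (Real.exp_pos _).le) (by linarith),
          ENNReal.ofReal_sum_of_nonneg fun j _ => mul_nonneg (hp0 j) (Real.exp_pos _).le]
        simp only [ENNReal.ofReal_mul (hp0 _)]
    _ = ∑ j ∈ s, ENNReal.ofReal (p j) *
          ∫⁻ ω, ENNReal.ofReal (Real.exp (c / p j * inner ℝ (ξ ω) (e j) ^ 2)) ∂P
          + ENNReal.ofReal (1 - ∑ j ∈ s, p j) := by
        have hm : ∀ j, Measurable fun ω =>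
            ENNReal.ofReal (Real.exp (c / p j * inner ℝ (ξ ω) (e j) ^ 2)) := fun j =>
          (((hmeas j).pow_const 2).const_mul _).exp.ennreal_ofReal
        rw [lintegral_add_right _ measurable_const, lintegral_finsetSum _
          fun j _ => (hm j).const_mul _]
        simp only [lintegral_const_mul _ (hm _), lintegral_const, measure_univ, mul_one]
    _ ≤ ∑ j ∈ s, ENNReal.ofReal (p j) * ENNReal.ofReal (Real.exp (2 * c * (h * trace e Q)))
          + ENNReal.ofReal (1 - ∑ j ∈ s, p j) := by
        exact add_le_add_left (Finset.sum_le_sum fun j _ => hmom j) _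
    _ = ENNReal.ofReal ((∑ j ∈ s, p j) * Real.exp (2 * c * (h * trace e Q))
          + (1 - ∑ j ∈ s, p j)) := by
        rw [ENNReal.ofReal_add (mul_nonneg (Finset.sum_nonneg fun j _ => hp0 j)
          (Real.exp_pos _).le) (by linarith), ENNReal.ofReal_mul (Finset.sum_nonneg
          fun j _ => hp0 j), ENNReal.ofReal_sum_of_nonneg fun j _ => hp0 j, Finset.sum_mul]
    _ ≤ _ := by
        refine ENNReal.ofReal_le_ofReal ?_
        nlinarith

/-- A Fernique-type bound. -/
lemma lintegral_exp_norm_sq_le [TopologicalSpace.SeparableSpace K] (hQ : Q.IsPositive)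
    (hQtr : Summable fun j => inner ℝ (Q (e j)) (e j)) (hh : 0 ≤ h) (hξ : Measurable ξ)
    (hgauss : ∀ x, P.map (fun ω => inner ℝ (ξ ω) x) = gaussianReal 0 (h * inner ℝ (Q x) x).toNNReal)
    {c : ℝ} (hc : 0 ≤ c) (hch : 4 * c * (h * trace e Q) ≤ 1) :
    ∫⁻ ω, ENNReal.ofReal (Real.exp (c * ‖ξ ω‖ ^ 2)) ∂P
      ≤ ENNReal.ofReal (Real.exp (2 * c * (h * trace e Q))) := by
  have : Countable ι := countable_of_orthonormal e.orthonormal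
  set F : Finset ι → Ω → ℝ≥0∞ := fun s ω =>
    ENNReal.ofReal (Real.exp (c * ∑ j ∈ s, inner ℝ (ξ ω) (e j) ^ 2)) with hF
  have hmeas : ∀ s, Measurable (F s) := fun s =>
    ((Finset.measurable_fun_sum s fun j _ => (((continuous_id.inner
      continuous_const).measurable.comp hξ).pow_const 2)).const_mul c).exp.ennreal_ofReal
  have hmono : Monotone F := by
    intro s t hst ω
    refine ENNReal.ofReal_le_ofReal (Real.exp_le_exp.2 (mul_le_mul_of_nonneg_left ?_ hc))
    exact Finset.sum_le_sum_of_subset_of_nonneg hst fun _ _ _ => sq_nonneg _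
  have hsup : ∀ ω, ENNReal.ofReal (Real.exp (c * ‖ξ ω‖ ^ 2)) ≤ ⨆ s, F s ω := by
    intro ω
    have h1 : Filter.Tendsto _ _ _ := hasSum_inner_sq e (ξ ω)
    have h2 : Filter.Tendsto (fun s => F s ω) Filter.atTop
        (nhds (ENNReal.ofReal (Real.exp (c * ‖ξ ω‖ ^ 2)))) :=
      ENNReal.tendsto_ofReal ((Real.continuous_exp.tendsto _).comp (h1.const_mul c))
    exact le_of_tendsto' h2 fun s => le_iSup (fun s => F s ω) s
  refine (lintegral_mono hsup).trans ?_
  rw [lintegral_iSup_directed_of_measurable hmeas hmono.directed_le]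
  exact iSup_le fun s => lintegral_exp_sum_sq_le hQ hQtr hh hξ hgauss hc hch s

lemma lintegral_exp_inner_add_norm_sq_le [TopologicalSpace.SeparableSpace K] (hQ : Q.IsPositive)
    (hQtr : Summable fun j => inner ℝ (Q (e j)) (e j)) (hh : 0 ≤ h) (hξ : Measurable ξ)
    (hgauss : ∀ x, P.map (fun ω => inner ℝ (ξ ω) x) = gaussianReal 0 (h * inner ℝ (Q x) x).toNNReal)
    {b : ℝ} (hb : 0 ≤ b) (hbh : 8 * b * (h * trace e Q) ≤ 1) (x : K) :
    ∫⁻ ω, ENNReal.ofReal (Real.exp (inner ℝ (ξ ω) x + b * ‖ξ ω‖ ^ 2)) ∂P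
      ≤ ENNReal.ofReal (Real.exp (h * trace e Q * ‖x‖ ^ 2 + 2 * b * (h * trace e Q))) := by
  have hm1 : Measurable fun ω => ENNReal.ofReal (Real.exp (inner ℝ (ξ ω) x)) :=
    ((continuous_id.inner continuous_const).measurable.comp hξ).exp.ennreal_ofReal
  have hm2 : Measurable fun ω => ENNReal.ofReal (Real.exp (b * ‖ξ ω‖ ^ 2)) :=
    ((hξ.norm.pow_const 2).const_mul b).exp.ennreal_ofReal
  have hcs := ENNReal.lintegral_mul_le_Lp_mul_Lq P Real.HolderConjugate.two_two
    hm1.aemeasurable hm2.aemeasurable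
  have hsq : ∀ r : ℝ, ENNReal.ofReal (Real.exp r) ^ (2 : ℝ) = ENNReal.ofReal (Real.exp (2 * r)) := by
    intro r
    rw [ENNReal.ofReal_rpow_of_pos (Real.exp_pos _), ← Real.exp_mul, mul_comm]
  have hsqrt : ∀ r : ℝ, ENNReal.ofReal (Real.exp r) ^ (1 / 2 : ℝ)
      = ENNReal.ofReal (Real.exp (r / 2)) := by
    intro r
    rw [ENNReal.ofReal_rpow_of_pos (Real.exp_pos _), ← Real.exp_mul]
    congr 2; ring
  have h1 : ∫⁻ ω, ENNReal.ofReal (Real.exp (2 * inner ℝ (ξ ω) x)) ∂P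
      ≤ ENNReal.ofReal (Real.exp (2 * (h * trace e Q * ‖x‖ ^ 2))) := by
    rw [lintegral_exp_inner hQ hh hξ hgauss]
    refine ENNReal.ofReal_le_ofReal (Real.exp_le_exp.2 ?_)
    have := mul_le_mul_of_nonneg_left (inner_le_trace hQ e hQtr x) hh
    nlinarith
  have h2 := lintegral_exp_norm_sq_le (e := e) hQ hQtr hh hξ hgauss (c := 2 * b) (by positivity)
    (by linarith)
  simp only [Pi.mul_apply, hsq, ← mul_assoc, ← ENNReal.ofReal_mul (Real.exp_pos _).le,
    ← Real.exp_add] at hcs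
  refine hcs.trans ?_
  calc _ ≤ ENNReal.ofReal (Real.exp (2 * (h * trace e Q * ‖x‖ ^ 2))) ^ (1 / 2 : ℝ)
        * ENNReal.ofReal (Real.exp (2 * (2 * b) * (h * trace e Q))) ^ (1 / 2 : ℝ) := by
        gcongr
    _ = _ := by
        rw [hsqrt, hsqrt, ← ENNReal.ofReal_mul (Real.exp_pos _).le, ← Real.exp_add]
        congr 2; ring

end gaussian

/-! ### A maximal inequality for positive supermartingales -/

lemma bellman_le {θ m y : ℝ} (hθ0 : 0 < θ) (hθ1 : θ < 1) (hm : 0 < m) (hy : 0 < y) :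
    max m y ^ θ + θ / (1 - θ) * (y * max m y ^ (θ - 1)) ≤ m ^ θ + θ / (1 - θ) * (y * m ^ (θ - 1)) := by
  rcases le_total y m with h | h
  · rw [max_eq_left h]
  rw [max_eq_right h]
  have hθ : 0 < 1 - θ := by linarith
  have h1 := Real.geom_mean_le_arith_mean2_weighted hθ0.le hθ.le hy.le hm.le (by ring)
  have h2 : y * y ^ (θ - 1) = y ^ θ := by
    rw [Real.rpow_sub_one hy.ne']; field_simp
  have h3 : m ^ (1 - θ) * m ^ (θ - 1) = 1 := by
    rw [← Real.rpow_add hm]; simp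
  have h4 : m * m ^ (θ - 1) = m ^ θ := by
    rw [Real.rpow_sub_one hm.ne']; field_simp
  have h5 : 0 < m ^ (θ - 1) := Real.rpow_pos_of_pos hm _
  have h6 : y ^ θ ≤ θ * (y * m ^ (θ - 1)) + (1 - θ) * m ^ θ := by
    calc y ^ θ = (y ^ θ * m ^ (1 - θ)) * m ^ (θ - 1) := by rw [mul_assoc, h3, mul_one]
      _ ≤ (θ * y + (1 - θ) * m) * m ^ (θ - 1) := by gcongr
      _ = _ := by rw [← h4]; ring
  rw [h2, ← sub_nonneg]
  have h7 : m ^ θ + θ / (1 - θ) * (y * m ^ (θ - 1)) - (y ^ θ + θ / (1 - θ) * y ^ θ)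
      = (θ * (y * m ^ (θ - 1)) + (1 - θ) * m ^ θ - y ^ θ) / (1 - θ) := by
    field_simp; ring
  rw [h7]
  exact div_nonneg (by linarith) hθ.le

lemma sup'_range_succ (f : ℕ → ℝ) (n : ℕ) :
    (Finset.range (n + 1 + 1)).sup' Finset.nonempty_range_add_one f
      = max ((Finset.range (n + 1)).sup' Finset.nonempty_range_add_one f) (f (n + 1)) := by
  refine le_antisymm (Finset.sup'_le _ _ fun i hi => ?_) (max_le (Finset.sup'_le _ _ fun i hi => ?_)
    (Finset.le_sup' f (Finset.self_mem_range_succ _)))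
  · rcases (Nat.lt_succ_iff_lt_or_eq.1 (Finset.mem_range.1 hi)) with h | h
    · exact le_max_of_le_left (Finset.le_sup' f (Finset.mem_range.2 h))
    · rw [h]; exact le_max_right _ _
  · exact Finset.le_sup' f (Finset.mem_range.2 ((Finset.mem_range.1 hi).trans (Nat.lt_succ_self _)))

lemma measurable_sup'_range {Ω : Type*} {m : MeasurableSpace Ω} {Y : ℕ → Ω → ℝ} (n : ℕ)
    (hY : ∀ l ≤ n, Measurable (Y l)) :
    Measurable fun ω => (Finset.range (n + 1)).sup' Finset.nonempty_range_add_one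
      fun l => Y l ω := by
  have := Finset.measurable_sup' (s := Finset.range (n + 1)) Finset.nonempty_range_add_one
    (f := Y) fun l hl => hY l (Nat.lt_succ_iff.1 (Finset.mem_range.1 hl))
  convert this using 1
  ext ω
  rw [Finset.sup'_apply]

/-- Moments of order `θ < 1` of the maximum of a positive supermartingale. -/
theorem lintegral_max_rpow_le {Ω : Type*} {mΩ : MeasurableSpace Ω} {P : Measure Ω}
    {m : ℕ → MeasurableSpace Ω} (hm : ∀ l, m l ≤ mΩ) (hmono : Monotone m)
    {Y : ℕ → Ω → ℝ} {N : ℕ} (hpos : ∀ l ω, 0 < Y l ω)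
    (hmeas : ∀ l ≤ N, Measurable[m l] (Y l))
    (hsuper : ∀ l < N, ∀ f : Ω → ℝ≥0∞, Measurable[m l] f →
      ∫⁻ ω, f ω * ENNReal.ofReal (Y (l + 1) ω) ∂P ≤ ∫⁻ ω, f ω * ENNReal.ofReal (Y l ω) ∂P)
    {θ : ℝ} (hθ0 : 0 < θ) (hθ1 : θ < 1) :
    ∫⁻ ω, ENNReal.ofReal (((Finset.range (N + 1)).sup' Finset.nonempty_range_add_one
      fun l => Y l ω) ^ θ) ∂P
      ≤ ∫⁻ ω, ENNReal.ofReal (Y 0 ω ^ θ / (1 - θ)) ∂P := by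
  set M : ℕ → Ω → ℝ := fun n ω =>
    (Finset.range (n + 1)).sup' Finset.nonempty_range_add_one fun l => Y l ω with hM
  set c := θ / (1 - θ) with hc
  have hc0 : 0 ≤ c := div_nonneg hθ0.le (by linarith)
  have hMpos : ∀ n ω, 0 < M n ω := fun n ω =>
    (hpos 0 ω).trans_le (Finset.le_sup' (fun l => Y l ω) (Finset.mem_range.2 (Nat.succ_pos n)))
  have hMmeas : ∀ n ≤ N, Measurable[m n] (M n) := fun n hn =>
    measurable_sup'_range (m := m n) n fun l hl => (hmeas l (hl.trans hn)).mono (hmono hl) le_rfl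
  have hind : ∀ n ≤ N, ∫⁻ ω, ENNReal.ofReal (M n ω ^ θ + c * (Y n ω * M n ω ^ (θ - 1))) ∂P
      ≤ ∫⁻ ω, ENNReal.ofReal (Y 0 ω ^ θ / (1 - θ)) ∂P := by
    intro n
    induction n with
    | zero =>
      intro _
      refine lintegral_mono fun ω => ENNReal.ofReal_le_ofReal (le_of_eq ?_)
      have h0 : M 0 ω = Y 0 ω := by simp [hM]
      have h1 : Y 0 ω * Y 0 ω ^ (θ - 1) = Y 0 ω ^ θ := by
        rw [Real.rpow_sub_one (hpos 0 ω).ne']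
        field_simp [(hpos 0 ω).ne']
      have h2 : 1 - θ ≠ 0 := by linarith
      rw [h0, h1, hc]
      field_simp
      ring
    | succ n ih =>
      intro hn
      have hn' : n ≤ N := (Nat.le_succ n).trans hn
      refine le_trans ?_ (ih hn')
      have hsplit : ∀ ω (y : ℝ), 0 < y →
          ENNReal.ofReal (M n ω ^ θ + c * (y * M n ω ^ (θ - 1)))
          = ENNReal.ofReal (M n ω ^ θ)
            + ENNReal.ofReal (c * M n ω ^ (θ - 1)) * ENNReal.ofReal y := by
        intro ω y hy
        have h1 := Real.rpow_nonneg (hMpos n ω).le (θ - 1)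
        rw [ENNReal.ofReal_add (Real.rpow_nonneg (hMpos n ω).le _) (by positivity),
          ← ENNReal.ofReal_mul (by positivity)]
        congr 2; ring
      have hMm := (hMmeas n hn').mono (hm n) le_rfl
      have hf : Measurable[m n] fun ω => ENNReal.ofReal (c * M n ω ^ (θ - 1)) :=
        (((hMmeas n hn').pow_const _).const_mul c).ennreal_ofReal
      calc ∫⁻ ω, ENNReal.ofReal (M (n + 1) ω ^ θ + c * (Y (n + 1) ω * M (n + 1) ω ^ (θ - 1))) ∂P
          ≤ ∫⁻ ω, ENNReal.ofReal (M n ω ^ θ + c * (Y (n + 1) ω * M n ω ^ (θ - 1))) ∂P := by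
            refine lintegral_mono fun ω => ENNReal.ofReal_le_ofReal ?_
            simp only [hM]
            rw [sup'_range_succ]
            exact bellman_le hθ0 hθ1 (hMpos n ω) (hpos _ ω)
        _ = ∫⁻ ω, ENNReal.ofReal (M n ω ^ θ) ∂P
            + ∫⁻ ω, ENNReal.ofReal (c * M n ω ^ (θ - 1)) * ENNReal.ofReal (Y (n + 1) ω) ∂P := by
            simp only [hsplit _ _ (hpos _ _)]
            rw [lintegral_add_left (hMm.pow_const _).ennreal_ofReal]
        _ ≤ ∫⁻ ω, ENNReal.ofReal (M n ω ^ θ) ∂P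
            + ∫⁻ ω, ENNReal.ofReal (c * M n ω ^ (θ - 1)) * ENNReal.ofReal (Y n ω) ∂P := by
            gcongr 1
            exact hsuper n hn _ hf
        _ = _ := by
            simp only [hsplit _ _ (hpos _ _)]
            rw [lintegral_add_left (hMm.pow_const _).ennreal_ofReal]
  refine le_trans (lintegral_mono fun ω => ENNReal.ofReal_le_ofReal ?_) (hind N le_rfl)
  have h1 := Real.rpow_nonneg (hMpos N ω).le (θ - 1)
  have h2 := (hpos N ω).le
  have h3 : 0 ≤ c * (Y N ω * M N ω ^ (θ - 1)) := by positivity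
  exact le_add_of_nonneg_right h3

/-! ### Conditioning on the past -/

lemma lintegral_of_indepFun {Ω A B : Type*} {mΩ : MeasurableSpace Ω} [MeasurableSpace A]
    [MeasurableSpace B] {P : Measure Ω} [IsProbabilityMeasure P] {X : Ω → A} {Z : Ω → B}
    (hX : Measurable X) (hZ : Measurable Z) (hind : IndepFun X Z P) {Φ : A × B → ℝ≥0∞}
    (hΦ : Measurable Φ) :
    ∫⁻ ω, Φ (X ω, Z ω) ∂P = ∫⁻ ω, ∫⁻ ω', Φ (X ω, Z ω') ∂P ∂P := by
  have h1 : ∫⁻ ω, Φ (X ω, Z ω) ∂P = ∫⁻ x, Φ x ∂(P.map X).prod (P.map Z) := by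
    rw [← hind.map_prod_eq_prod_map_map hX.aemeasurable hZ.aemeasurable,
      lintegral_map hΦ (hX.prodMk hZ)]
  have : IsProbabilityMeasure (P.map Z) := Measure.isProbabilityMeasure_map hZ.aemeasurable
  rw [h1, lintegral_prod _ hΦ.aemeasurable, lintegral_map hΦ.lintegral_prod_right' hX]
  refine lintegral_congr fun ω => ?_
  exact lintegral_map (hΦ.comp measurable_prodMk_left) hZ

section conditioning

variable {Ω : Type*} {m mΩ : MeasurableSpace Ω} {P : Measure Ω} [IsProbabilityMeasure P]
  {K : Type*} [NormedAddCommGroup K] [InnerProductSpace ℝ K] [MeasurableSpace K] [BorelSpace K]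
  [TopologicalSpace.SeparableSpace K]
  {Q : K →L[ℝ] K} {ι : Type*} {e : HilbertBasis ι ℝ K} {ξ : Ω → K} {h : ℝ}

lemma lintegral_mul_exp_le (hm : m ≤ mΩ) (hQ : Q.IsPositive)
    (hQtr : Summable fun j => inner ℝ (Q (e j)) (e j)) (hh : 0 ≤ h) (hξ : Measurable ξ)
    (hgauss : ∀ x, P.map (fun ω => inner ℝ (ξ ω) x) = gaussianReal 0 (h * inner ℝ (Q x) x).toNNReal)
    (hind : Indep (MeasurableSpace.comap ξ inferInstance) m P)
    {b : ℝ} (hb : 0 ≤ b) (hbh : 8 * b * (h * trace e Q) ≤ 1)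
    {f : Ω → ℝ≥0∞} (hf : Measurable[m] f) {g : Ω → K} (hg : Measurable[m] g) :
    ∫⁻ ω, f ω * ENNReal.ofReal (Real.exp (inner ℝ (ξ ω) (g ω) + b * ‖ξ ω‖ ^ 2)) ∂P
      ≤ ∫⁻ ω, f ω * ENNReal.ofReal
        (Real.exp (h * trace e Q * ‖g ω‖ ^ 2 + 2 * b * (h * trace e Q))) ∂P := by
  have : SecondCountableTopology K := UniformSpace.secondCountable_of_separable K
  let Φ : (ℝ≥0∞ × K) × K → ℝ≥0∞ := fun x =>
    x.1.1 * ENNReal.ofReal (Real.exp (inner ℝ x.2 x.1.2 + b * ‖x.2‖ ^ 2))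
  have hΦ : Measurable Φ := by
    refine measurable_fst.fst.mul (Measurable.ennreal_ofReal (Measurable.exp ?_))
    exact (measurable_snd.inner measurable_fst.snd).add ((measurable_snd.norm.pow_const 2).const_mul b)
  have hX : Measurable[m] fun ω => (f ω, g ω) := hf.prodMk hg
  have hindep : IndepFun (fun ω => (f ω, g ω)) ξ P := by
    rw [IndepFun_iff_Indep]
    exact indep_of_indep_of_le_left hind.symm hX.comap_le
  have key := lintegral_of_indepFun (hX.mono hm le_rfl) hξ hindep hΦ
  refine key.trans_le (lintegral_mono fun ω => ?_)
  have hmeas : Measurable fun ω' =>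
      ENNReal.ofReal (Real.exp (inner ℝ (ξ ω') (g ω) + b * ‖ξ ω'‖ ^ 2)) :=
    (Measurable.exp ((hξ.inner measurable_const).add
      ((hξ.norm.pow_const 2).const_mul b))).ennreal_ofReal
  change ∫⁻ ω', f ω * ENNReal.ofReal (Real.exp (inner ℝ (ξ ω') (g ω) + b * ‖ξ ω'‖ ^ 2)) ∂P ≤ _
  rw [lintegral_const_mul _ hmeas]
  gcongr
  exact lintegral_exp_inner_add_norm_sq_le hQ hQtr hh hξ hgauss hb hbh (g ω)

lemma measurable_of_inner {Ω : Type*} [MeasurableSpace Ω] {ι : Type*} (e : HilbertBasis ι ℝ K)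
    {g : Ω → K} (hg : ∀ j, Measurable fun ω => inner ℝ (e j) (g ω)) : Measurable g := by
  have : Countable ι := countable_of_orthonormal e.orthonormal
  have : SecondCountableTopology K := UniformSpace.secondCountable_of_separable K
  refine measurable_of_tendsto_metrizable' Filter.atTop
    (f := fun (s : Finset ι) ω => ∑ j ∈ s, inner ℝ (e j) (g ω) • e j)
    (fun s => Finset.measurable_fun_sum s fun j _ => (hg j).smul_const (e j)) ?_
  rw [tendsto_pi_nhds]
  intro ω
  have h := e.hasSum_repr (g ω)
  simp only [HilbertBasis.repr_apply_apply] at h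
  exact h

end conditioning

/-! ### Measurability of the diffusion coefficient -/

lemma norm_comp_le {L : ℝ} (u : L2v L) (i : Fin 2) : ‖comp u i‖ ≤ ‖u‖ :=
  PiLp.norm_apply_le (p := 2) (β := fun _ : Fin 2 => Lsq L)
    ((show meanZero L from u) : PiLp 2 fun _ : Fin 2 => Lsq L) i

lemma continuous_comp_inner {L : ℝ} (i : Fin 2) (f : Lsq L) :
    Continuous fun u : L2v L => inner ℝ (comp u i) f := by
  have h : Continuous fun u : L2v L => comp u i := by
    refine LipschitzWith.continuous (K := 1) (LipschitzWith.of_dist_le_mul fun u v => ?_)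
    rw [dist_eq_norm, dist_eq_norm, NNReal.coe_one, one_mul]
    exact norm_comp_le (u - v) i
  exact h.inner continuous_const

section diffusion

variable {K : Type*} [NormedAddCommGroup K] [InnerProductSpace ℝ K] {L : ℝ}
  {G : L2v L → K →L[ℝ] W12 L} {K₀ K₁ L₁ : ℝ}

lemma continuous_toL2_diffusion (hG : ConditionG1 G K₀ K₁ L₁) (x : K) :
    Continuous fun v => toL2 L (G v x) := by
  refine LipschitzWith.continuous (K := (√L₁ * ‖x‖).toNNReal)
    (LipschitzWith.of_dist_le_mul fun u v => ?_)
  rw [dist_eq_norm, dist_eq_norm, Real.coe_toNNReal _ (by positivity), ← map_sub]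
  have h1 : ‖(toL2 L).comp (G u - G v)‖ ≤ √L₁ * ‖u - v‖ := by
    have h := Real.sqrt_le_sqrt (hG.lipschitz u v)
    rwa [Real.sqrt_sq (norm_nonneg _), Real.sqrt_mul' _ (sq_nonneg _),
      Real.sqrt_sq (norm_nonneg _)] at h
  calc ‖toL2 L (G u x - G v x)‖ = ‖((toL2 L).comp (G u - G v)) x‖ := rfl
    _ ≤ ‖(toL2 L).comp (G u - G v)‖ * ‖x‖ := ContinuousLinearMap.le_opNorm _ _
    _ ≤ (√L₁ * ‖u - v‖) * ‖x‖ := by gcongr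
    _ = _ := by ring

lemma measurable_vcoeff_of_continuous {Ω : Type*} {m : MeasurableSpace Ω} {u : Ω → W12 L}
    (hu : ∀ (i : Fin 2) (f : Lsq L), Measurable fun ω => inner ℝ (comp (toL2 L (u ω)) i) f)
    (i : Fin 2) (k : Fin 2 → ℤ) : Measurable fun ω => vcoeff (u ω) i k := by
  have hc : Continuous (cosMode L k) := Real.continuous_cos.comp (continuous_phase L k)
  have hs : Continuous (sinMode L k) := Real.continuous_sin.comp (continuous_phase L k)
  have h : (fun ω => vcoeff (u ω) i k) = fun ω => ((((L ^ 2)⁻¹ : ℝ) : ℂ) *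
      ((inner ℝ (comp (toL2 L (u ω)) i) (ofCont L _ hc) : ℝ)
        - (inner ℝ (comp (toL2 L (u ω)) i) (ofCont L _ hs) : ℝ) * Complex.I)) := by
    ext ω
    rw [vcoeff, rcoeff, fcoeff_ofReal (Lsq_integrable _), inner_ofCont, inner_ofCont]
  rw [h]
  exact ((Complex.measurable_ofReal.comp (hu i _)).sub
    ((Complex.measurable_ofReal.comp (hu i _)).mul_const _)).const_mul _

lemma measurable_inner_W12 (hL : 0 < L) {Ω : Type*} {m : MeasurableSpace Ω} {u v : Ω → W12 L}
    (hu : ∀ (i : Fin 2) (f : Lsq L), Measurable fun ω => inner ℝ (comp (toL2 L (u ω)) i) f)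
    (hv : ∀ (i : Fin 2) (f : Lsq L), Measurable fun ω => inner ℝ (comp (toL2 L (v ω)) i) f) :
    Measurable fun ω => inner ℝ (u ω) (v ω) := by
  have key : Measurable fun ω => (L ^ 2)⁻¹ * inner ℝ (u ω) (v ω) := by
    refine measurable_of_tendsto_metrizable' Filter.atTop
      (f := fun (s : Finset (Fin 2 → ℤ)) ω => ∑ k ∈ s,
        ((∑ i, (starRingEnd ℂ) (vcoeff (u ω) i k) * vcoeff (v ω) i k)
        + ((2 * Real.pi / L) ^ 2 * lenSq k : ℝ) *
          ∑ i, (starRingEnd ℂ) (vcoeff (u ω) i k) * vcoeff (v ω) i k).re) (fun s => ?_) ?_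
    · have hsum : ∀ k, Measurable fun ω =>
          ∑ i, (starRingEnd ℂ) (vcoeff (u ω) i k) * vcoeff (v ω) i k := fun k =>
        Finset.measurable_fun_sum _ fun i _ => (Complex.continuous_conj.measurable.comp
          (measurable_vcoeff_of_continuous hu i k)).mul (measurable_vcoeff_of_continuous hv i k)
      exact Finset.measurable_fun_sum s fun k _ => Complex.measurable_re.comp
        ((hsum k).add ((hsum k).const_mul _))
    · rw [tendsto_pi_nhds]
      intro ω
      have h := Complex.hasSum_re
        ((hasSum_inner_toL2 hL (u ω) (v ω)).add (hasSum_inner_grad hL (u ω) (v ω)))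
      rw [← Complex.ofReal_add, Complex.ofReal_re, ← mul_add, ← inner_W12] at h
      exact h
  have h2 := key.const_mul (L ^ 2)
  have hL2 : L ^ 2 ≠ 0 := by positivity
  simpa only [mul_inv_cancel_left₀ hL2] using h2

/-- The vector `G(u)^* u`. -/
def dualVec [CompleteSpace K] (G : L2v L → K →L[ℝ] W12 L) (u : W12 L) : K :=
  (InnerProductSpace.toDual ℝ K).symm ((innerSL ℝ u).comp (G (toL2 L u)))

lemma inner_dualVec [CompleteSpace K] (u : W12 L) (x : K) :
    inner ℝ (dualVec G u) x = inner ℝ u (G (toL2 L u) x) := by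
  rw [dualVec, InnerProductSpace.toDual_symm_apply]; rfl

lemma norm_dualVec_sq_le [CompleteSpace K] (hG : ConditionG1 G K₀ 0 L₁) (u : W12 L) :
    ‖dualVec G u‖ ^ 2 ≤ K₀ * ‖u‖ ^ 2 := by
  have h1 : ‖dualVec G u‖ ≤ ‖u‖ * ‖G (toL2 L u)‖ := by
    rw [dualVec, LinearIsometryEquiv.norm_map]
    refine (ContinuousLinearMap.opNorm_comp_le _ _).trans_eq ?_
    rw [innerSL_apply_norm]
  have h2 := hG.growth_W12 u
  rw [zero_mul, add_zero] at h2
  calc ‖dualVec G u‖ ^ 2 ≤ (‖u‖ * ‖G (toL2 L u)‖) ^ 2 := by gcongr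
    _ = ‖G (toL2 L u)‖ ^ 2 * ‖u‖ ^ 2 := by ring
    _ ≤ _ := by gcongr

lemma measurable_dualVec [CompleteSpace K] [TopologicalSpace.SeparableSpace K]
    [MeasurableSpace K] [BorelSpace K] (hL : 0 < L) {ι : Type*} (e : HilbertBasis ι ℝ K)
    (hG : ConditionG1 G K₀ K₁ L₁)
    {Ω : Type*} {m : MeasurableSpace Ω} {u : Ω → V L} (hu : StronglyMeasurable u) :
    Measurable fun ω => dualVec G (u ω : W12 L) := by
  refine measurable_of_inner e fun j => ?_
  simp only [real_inner_comm (dualVec G _) (e j), inner_dualVec]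
  have hc : Continuous fun v : V L => toL2 L (v : W12 L) :=
    (toL2 L).continuous.comp continuous_subtype_val
  refine measurable_inner_W12 hL (fun i f => ?_) (fun i f => ?_)
  · exact (((continuous_comp_inner i f).comp hc).comp_stronglyMeasurable hu).measurable
  · exact (((continuous_comp_inner i f).comp ((continuous_toL2_diffusion hG (e j)).comp
      hc)).comp_stronglyMeasurable hu).measurable

end diffusion

/-! ### The Euler scheme -/

lemma grid_mono (T : ℝ≥0) (N : ℕ) : Monotone (grid T N) := by
  intro a b hab
  unfold grid
  gcongr

lemma grid_le {T : ℝ≥0} {N l : ℕ} (hl : l ≤ N) (hN : 0 < N) : grid T N l ≤ T := by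
  unfold grid
  have hN' : (0 : ℝ≥0) < N := by exact_mod_cast hN
  rw [div_le_iff₀ hN', mul_comm]
  gcongr

lemma grid_sub (T : ℝ≥0) (N l : ℕ) :
    ((grid T N (l + 1) : ℝ≥0) : ℝ) - grid T N l = (T : ℝ) / N := by
  unfold grid
  push_cast
  ring

lemma exists_gt_mul_le {α A ν : ℝ} (hA : 0 ≤ A) (h : α * A < ν) : ∃ β, α < β ∧ β * A ≤ ν := by
  rcases hA.eq_or_lt with rfl | hA
  · exact ⟨α + 1, by linarith, by simpa using (by simpa using h : 0 < ν).le⟩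
  · exact ⟨ν / A, by rwa [lt_div_iff₀ hA], by rw [div_mul_cancel₀ _ hA.ne']⟩

section scheme

variable {Ω : Type*} {mΩ : MeasurableSpace Ω} {P : Measure Ω} [IsProbabilityMeasure P]
  {ℱ : Filtration ℝ≥0 mΩ} {K : Type*} [NormedAddCommGroup K] [InnerProductSpace ℝ K]
  [CompleteSpace K] [TopologicalSpace.SeparableSpace K] [MeasurableSpace K] [BorelSpace K]
  {L : ℝ} {T : ℝ≥0} {ν : ℝ} {Q : K →L[ℝ] K} {ι : Type*} {e : HilbertBasis ι ℝ K}
  {W : ℝ≥0 → Ω → K} {G : L2v L → K →L[ℝ] W12 L} {K₀ L₁ : ℝ} {u₀ : V L} {N : ℕ}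
  {u : ℕ → Ω → V L}

omit [IsProbabilityMeasure P] [TopologicalSpace.SeparableSpace K] [MeasurableSpace K]
  [BorelSpace K] in
lemma IsEulerScheme.norm_sq_step (hL : 0 < L) (hT : 0 < T) (hν : 0 < ν)
    (hG : ConditionG1 G K₀ 0 L₁) (hu : IsEulerScheme P ℱ T ν W G u₀ N u) {l : ℕ} (hl : l < N) :
    ∀ᵐ ω ∂P, (1 + 2 * ((T : ℝ) / N * ν * (2 * Real.pi / L) ^ 2)) * ‖u (l + 1) ω‖ ^ 2
      ≤ ‖u l ω‖ ^ 2
        + 2 * inner ℝ (W (grid T N (l + 1)) ω - W (grid T N l) ω) (dualVec G (u l ω : W12 L))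
        + K₀ * ‖W (grid T N (l + 1)) ω - W (grid T N l) ω‖ ^ 2 := by
  have hN : (0 : ℝ) < N := by exact_mod_cast (Nat.zero_le l).trans_lt hl
  have hT' : (0 : ℝ) < T := hT
  filter_upwards [hu.step l hl] with ω hω
  set ξ := W (grid T N (l + 1)) ω - W (grid T N l) ω
  set y := G (toL2 L (u l ω : W12 L)) ξ with hy
  have h1 := norm_sq_le_norm_sq hL (u (l + 1) ω) ((u l ω : W12 L) + y) (div_pos hT' hN) hν
    (fun φ => by
      have h := hω φ
      rw [inner_sub_left] at h
      rw [map_add, inner_sub_left, inner_add_left]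
      linarith)
  refine h1.trans ?_
  have h0 : inner ℝ (u l ω : W12 L) y = inner ℝ ξ (dualVec G (u l ω : W12 L)) :=
    (inner_dualVec _ _).symm.trans (real_inner_comm _ _)
  rw [norm_add_sq_real, h0, Submodule.coe_norm]
  have h2 : ‖y‖ ^ 2 ≤ K₀ * ‖ξ‖ ^ 2 := by
    have h3 := hG.growth_W12 (u l ω : W12 L)
    rw [zero_mul, add_zero] at h3
    calc ‖y‖ ^ 2 ≤ (‖G (toL2 L (u l ω : W12 L))‖ * ‖ξ‖) ^ 2 := by
          gcongr
          exact ContinuousLinearMap.le_opNorm _ _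
      _ = ‖G (toL2 L (u l ω : W12 L))‖ ^ 2 * ‖ξ‖ ^ 2 := by ring
      _ ≤ _ := by gcongr
  linarith

/-- The exponential of the squared norm, suitably damped, is a supermartingale. -/
lemma IsEulerScheme.supermartingale (hL : 0 < L) (hT : 0 < T) (hν : 0 < ν) (hQ : Q.IsPositive)
    (hQtr : Summable fun j => inner ℝ (Q (e j)) (e j)) (hW : IsWiener P ℱ T Q W)
    (hK₀ : 0 < K₀) (hG : ConditionG1 G K₀ 0 L₁) (hu : IsEulerScheme P ℱ T ν W G u₀ N u)
    {β : ℝ} (hβ : 0 < β) (hβν : 2 * β * K₀ * trace e Q ≤ ν * (2 * Real.pi / L) ^ 2)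
    (hβN : 8 * (β * K₀) * ((T : ℝ) / N * trace e Q) ≤ 1) {l : ℕ} (hl : l < N)
    {f : Ω → ℝ≥0∞} (hf : Measurable[ℱ (grid T N l)] f) {δ r : ℝ}
    (hδ : δ = 2 * (β * K₀) * ((T : ℝ) / N * trace e Q))
    (hr : r = 1 + 2 * ((T : ℝ) / N * ν * (2 * Real.pi / L) ^ 2)) :
    ∫⁻ ω, f ω * ENNReal.ofReal
        (Real.exp (β * r * ‖u (l + 1) ω‖ ^ 2 - ((l + 1 : ℕ) : ℝ) * δ)) ∂P
      ≤ ∫⁻ ω, f ω * ENNReal.ofReal (Real.exp (β * r * ‖u l ω‖ ^ 2 - l * δ)) ∂P := by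
  have hN : 0 < N := (Nat.zero_le l).trans_lt hl
  set s := grid T N l with hs
  set t := grid T N (l + 1) with ht
  have hst : s ≤ t := grid_mono T N (Nat.le_succ l)
  have htT : t ≤ T := grid_le hl hN
  have hm := ℱ.le s
  set ξ : Ω → K := fun ω => W t ω - W s ω with hξdef
  have hξ : Measurable ξ := by
    have : SecondCountableTopology K := UniformSpace.secondCountable_of_separable K
    exact (((hW.adapted t htT).mono (ℱ.le t)).measurable).sub
      (((hW.adapted s (hst.trans htT)).mono (ℱ.le s)).measurable)
  have hul : StronglyMeasurable[ℱ s] (u l) := hu.adapted l hl.le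
  have hX : Measurable[ℱ s] fun ω => ‖u l ω‖ ^ 2 := (hul.norm.measurable).pow_const 2
  have hg : Measurable[ℱ s] fun ω => (2 * β) • dualVec G (u l ω : W12 L) :=
    (measurable_dualVec (m := ℱ s) hL e hG hul).const_smul (2 * β)
  have hf' : Measurable[ℱ s] fun ω => f ω *
      ENNReal.ofReal (Real.exp (β * ‖u l ω‖ ^ 2 - ((l + 1 : ℕ) : ℝ) * δ)) :=
    hf.mul (((hX.const_mul β).sub_const _).exp.ennreal_ofReal)
  have hgauss : ∀ x, P.map (fun ω => inner ℝ (ξ ω) x)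
      = gaussianReal 0 ((T : ℝ) / N * inner ℝ (Q x) x).toNNReal := by
    intro x
    rw [← grid_sub T N l]
    exact hW.gaussian s t hst htT x
  have hTN : (0 : ℝ) ≤ (T : ℝ) / N := by positivity
  have key := lintegral_mul_exp_le hm hQ hQtr hTN hξ hgauss (hW.indep s t hst htT)
    (b := β * K₀) (by positivity) hβN hf' hg
  calc ∫⁻ ω, f ω * ENNReal.ofReal
        (Real.exp (β * r * ‖u (l + 1) ω‖ ^ 2 - ((l + 1 : ℕ) : ℝ) * δ)) ∂P
      ≤ _ := by
        refine lintegral_mono_ae ?_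
        filter_upwards [hu.norm_sq_step hL hT hν hG hl] with ω hω
        rw [mul_assoc (f ω), ← ENNReal.ofReal_mul (Real.exp_pos _).le, ← Real.exp_add]
        gcongr
        rw [← hr] at hω
        have := mul_le_mul_of_nonneg_left hω hβ.le
        rw [inner_smul_right]
        simp only [hξdef]
        linarith
    _ ≤ _ := key
    _ ≤ _ := by
        refine lintegral_mono fun ω => ?_
        rw [mul_assoc (f ω), ← ENNReal.ofReal_mul (Real.exp_pos _).le, ← Real.exp_add]
        gcongr
        rw [norm_smul, mul_pow, Real.norm_eq_abs, sq_abs, ← hδ]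
        have htr := trace_nonneg hQ e
        have h1 : (T : ℝ) / N * trace e Q * ((2 * β) ^ 2 * ‖dualVec G (u l ω : W12 L)‖ ^ 2)
            ≤ β * (2 * ((T : ℝ) / N * ν * (2 * Real.pi / L) ^ 2)) * ‖u l ω‖ ^ 2 := by
          calc (T : ℝ) / N * trace e Q * ((2 * β) ^ 2 * ‖dualVec G (u l ω : W12 L)‖ ^ 2)
              ≤ (T : ℝ) / N * trace e Q * ((2 * β) ^ 2 * (K₀ * ‖u l ω‖ ^ 2)) := by
                gcongr
                exact norm_dualVec_sq_le hG _
            _ = 2 * β * ((T : ℝ) / N) * (2 * β * K₀ * trace e Q) * ‖u l ω‖ ^ 2 := by ring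
            _ ≤ 2 * β * ((T : ℝ) / N) * (ν * (2 * Real.pi / L) ^ 2) * ‖u l ω‖ ^ 2 := by gcongr
            _ = _ := by ring
        rw [hr]
        push_cast
        linarith

end scheme

end StochNS

end

theorem theorem8p1
    -- the torus, the time horizon, the viscosity
    (L : ℝ) (hL : 0 < L) (T : ℝ≥0) (hT : 0 < T) (ν : ℝ) (hν : 0 < ν)
    -- the filtered probability space
    {Ω : Type*} {mΩ : MeasurableSpace Ω} (P : Measure Ω) [IsProbabilityMeasure P]
    (ℱ : Filtration ℝ≥0 mΩ)
    -- the separable Hilbert space `K` and the positive trace-class operator `Q`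
    {K : Type*} [NormedAddCommGroup K] [InnerProductSpace ℝ K] [CompleteSpace K]
    [TopologicalSpace.SeparableSpace K] [MeasurableSpace K] [BorelSpace K]
    (Q : K →L[ℝ] K) (hQ : Q.IsPositive) {ι : Type*} (e : HilbertBasis ι ℝ K)
    (hQtr : Summable fun j => inner ℝ (Q (e j)) (e j))
    -- the Wiener process
    (W : ℝ≥0 → Ω → K) (hW : StochNS.IsWiener P ℱ T Q W)
    -- the diffusion coefficient, with `K₁ = 0`
    (G : StochNS.L2v L → K →L[ℝ] StochNS.W12 L) (K₀ L₁ : ℝ) (hK₀ : 0 < K₀) (hL₁ : 0 < L₁)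
    (hG : StochNS.ConditionG1 G K₀ 0 L₁)
    -- a constant in `|∇u|² ≤ Ct |Au|²` for `u ∈ Dom(A)`
    (Ct : ℝ) (hCt : ∀ w : StochNS.DomA L, ‖StochNS.grad L w.u‖ ^ 2 ≤ Ct * ‖w.A‖ ^ 2)
    -- the deterministic initial condition
    (u₀ : StochNS.V L)
    -- `0 < α < ν / (2 Ct K₀ Tr Q)`, where the right side is `+∞` if `Q = 0`
    (α : ℝ) (hα : 0 < α) (hα' : α * (2 * Ct * K₀ * StochNS.trace e Q) < ν) :
    ∃ C : ℝ, 0 < C ∧ ∃ N₀ : ℕ, ∀ N ≥ N₀, ∀ u : ℕ → Ω → StochNS.V L,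
      StochNS.IsEulerScheme P ℱ T ν W G u₀ N u →
        Integrable (fun ω => Real.exp (α *
          (Finset.range (N + 1)).sup' Finset.nonempty_range_add_one fun l => ‖u l ω‖ ^ 2)) P ∧
        ∫ ω, Real.exp (α *
          (Finset.range (N + 1)).sup' Finset.nonempty_range_add_one fun l => ‖u l ω‖ ^ 2) ∂P
            ≤ C := by
  have hκ : 1 ≤ Ct * (2 * Real.pi / L) ^ 2 := StochNS.one_le_const_mul hL hCt
  set κ := 2 * Real.pi / L with hκdef
  set τ := StochNS.trace e Q with hτ
  have hτ0 : 0 ≤ τ := StochNS.trace_nonneg hQ e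
  have hκ0 : 0 < κ ^ 2 := by positivity
  have hCt0 : 0 < Ct := by
    by_contra! h
    have := mul_nonpos_of_nonpos_of_nonneg h hκ0.le
    linarith
  obtain ⟨β, hαβ, hβ⟩ := StochNS.exists_gt_mul_le (by positivity) hα'
  have hβ0 : 0 < β := hα.trans hαβ
  have hβν : 2 * β * K₀ * τ ≤ ν * κ ^ 2 := by
    calc 2 * β * K₀ * τ ≤ 2 * β * K₀ * τ * (Ct * κ ^ 2) :=
          le_mul_of_one_le_right (by positivity) hκ
      _ = β * (2 * Ct * K₀ * τ) * κ ^ 2 := by ring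
      _ ≤ _ := by gcongr
  set θ := α / β with hθ
  have hθ0 : 0 < θ := by positivity
  have hθ1 : θ < 1 := (div_lt_one hβ0).2 hαβ
  have hθβ : θ * β = α := div_mul_cancel₀ _ hβ0.ne'
  set R : ℝ := 1 + 2 * ((T : ℝ) * ν * κ ^ 2) with hR
  set C : ℝ := Real.exp (θ * (2 * (β * K₀) * (T * τ))) * (Real.exp (α * R * ‖u₀‖ ^ 2) / (1 - θ))
    with hC
  have h1θ : 0 < 1 - θ := by linarith
  have hC0 : 0 < C := by positivity
  refine ⟨C, hC0, ⌈8 * (β * K₀) * (T * τ)⌉₊ + 1, fun N hN u hu => ?_⟩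
  have hN0 : 0 < N := by omega
  have hN0' : (0 : ℝ) < N := by exact_mod_cast hN0
  have hβN : 8 * (β * K₀) * ((T : ℝ) / N * τ) ≤ 1 := by
    have h1 : 8 * (β * K₀) * (T * τ) ≤ N :=
      (Nat.le_ceil _).trans (by exact_mod_cast (Nat.le_succ _).trans hN)
    calc 8 * (β * K₀) * ((T : ℝ) / N * τ) = 8 * (β * K₀) * (T * τ) / N := by ring
      _ ≤ 1 := div_le_one_of_le₀ h1 hN0'.le
  set δ : ℝ := 2 * (β * K₀) * ((T : ℝ) / N * τ) with hδ
  set r : ℝ := 1 + 2 * ((T : ℝ) / N * ν * κ ^ 2) with hr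
  have hδ0 : 0 ≤ δ := by positivity
  have hr1 : 1 ≤ r := le_add_of_nonneg_right (by positivity)
  have hrR : r ≤ R := by
    have : (T : ℝ) / N ≤ T := div_le_self T.2 (by exact_mod_cast hN0)
    rw [hr, hR]
    gcongr
  let Y : ℕ → Ω → ℝ := fun l ω => Real.exp (β * r * ‖u l ω‖ ^ 2 - l * δ)
  have hXmeas : ∀ l ≤ N, Measurable[ℱ (StochNS.grid T N l)] fun ω => ‖u l ω‖ ^ 2 := fun l hl =>
    ((hu.adapted l hl).norm.measurable).pow_const 2
  have hmax := StochNS.lintegral_max_rpow_le (P := P) (m := fun l => ℱ (StochNS.grid T N l))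
    (fun l => ℱ.le _) (fun a b hab => ℱ.mono (StochNS.grid_mono T N hab)) (Y := Y) (N := N)
    (fun l ω => Real.exp_pos _)
    (fun l hl => (((hXmeas l hl).const_mul (β * r)).sub_const _).exp)
    (fun l hl f hf => hu.supermartingale hL hT hν hQ hQtr hW hK₀ hG hβ0 hβν hβN hl hf hδ hr)
    hθ0 hθ1
  have hY0 : ∫⁻ ω, ENNReal.ofReal (Y 0 ω ^ θ / (1 - θ)) ∂P
      ≤ ENNReal.ofReal (Real.exp (α * R * ‖u₀‖ ^ 2) / (1 - θ)) := by
    calc _ ≤ ∫⁻ _, ENNReal.ofReal (Real.exp (α * R * ‖u₀‖ ^ 2) / (1 - θ)) ∂P := by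
          refine lintegral_mono_ae ?_
          filter_upwards [hu.init] with ω hω
          simp only [Y, hω, ← Real.exp_mul]
          refine ENNReal.ofReal_le_ofReal
            (div_le_div_of_nonneg_right (Real.exp_le_exp.2 ?_) h1θ.le)
          push_cast
          calc (β * r * ‖u₀‖ ^ 2 - 0 * δ) * θ = (θ * β) * r * ‖u₀‖ ^ 2 := by ring
            _ ≤ α * R * ‖u₀‖ ^ 2 := by rw [hθβ]; gcongr
      _ = _ := by simp
  have hNδ : (N : ℝ) * δ = 2 * (β * K₀) * (T * τ) := by
    rw [hδ]; field_simp
  have hpt : ∀ ω, Real.exp (α *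
      (Finset.range (N + 1)).sup' Finset.nonempty_range_add_one fun l => ‖u l ω‖ ^ 2)
      ≤ Real.exp (θ * (2 * (β * K₀) * (T * τ))) *
        ((Finset.range (N + 1)).sup' Finset.nonempty_range_add_one fun l => Y l ω) ^ θ := by
    intro ω
    obtain ⟨l, hl, hlmax⟩ := Finset.exists_mem_eq_sup' (s := Finset.range (N + 1))
      Finset.nonempty_range_add_one fun l => ‖u l ω‖ ^ 2
    have hlN : (l : ℝ) ≤ N := by exact_mod_cast Nat.lt_succ_iff.1 (Finset.mem_range.1 hl)
    have hYl : Y l ω ≤ (Finset.range (N + 1)).sup' Finset.nonempty_range_add_one fun l => Y l ω :=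
      Finset.le_sup' (fun l => Y l ω) hl
    rw [hlmax]
    calc Real.exp (α * ‖u l ω‖ ^ 2)
        ≤ Real.exp (θ * (2 * (β * K₀) * (T * τ))) * Y l ω ^ θ := by
          simp only [Y]
          rw [← Real.exp_mul, ← Real.exp_add, ← hNδ, ← hθβ]
          gcongr
          have h1 : θ * (l * δ) ≤ θ * (N * δ) := by gcongr
          have h2 : θ * β * ‖u l ω‖ ^ 2 * 1 ≤ θ * β * ‖u l ω‖ ^ 2 * r := by gcongr
          linarith
      _ ≤ _ := by
          have : 0 ≤ Y l ω := (Real.exp_pos _).le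
          gcongr
  have hfinal : ∫⁻ ω, ENNReal.ofReal (Real.exp (α *
      (Finset.range (N + 1)).sup' Finset.nonempty_range_add_one fun l => ‖u l ω‖ ^ 2)) ∂P
      ≤ ENNReal.ofReal C := by
    calc _ ≤ ∫⁻ ω, ENNReal.ofReal (Real.exp (θ * (2 * (β * K₀) * (T * τ)))) *
          ENNReal.ofReal (((Finset.range (N + 1)).sup' Finset.nonempty_range_add_one
            fun l => Y l ω) ^ θ) ∂P := by
          refine lintegral_mono fun ω => ?_
          rw [← ENNReal.ofReal_mul (Real.exp_pos _).le]
          exact ENNReal.ofReal_le_ofReal (hpt ω)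
      _ = ENNReal.ofReal (Real.exp (θ * (2 * (β * K₀) * (T * τ)))) *
          ∫⁻ ω, ENNReal.ofReal (((Finset.range (N + 1)).sup' Finset.nonempty_range_add_one
            fun l => Y l ω) ^ θ) ∂P := lintegral_const_mul' _ _ ENNReal.ofReal_ne_top
      _ ≤ _ := by
          rw [hC, ENNReal.ofReal_mul (Real.exp_pos _).le]
          gcongr
          exact hmax.trans hY0
  have hmeas : Measurable fun ω => Real.exp (α *
      (Finset.range (N + 1)).sup' Finset.nonempty_range_add_one fun l => ‖u l ω‖ ^ 2) :=
    ((StochNS.measurable_sup'_range N fun l hl => (hXmeas l hl).mono (ℱ.le _) le_rfl).const_mul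
      α).exp
  have hnn : 0 ≤ᵐ[P] fun ω => Real.exp (α *
      (Finset.range (N + 1)).sup' Finset.nonempty_range_add_one fun l => ‖u l ω‖ ^ 2) :=
    .of_forall fun ω => (Real.exp_pos _).le
  refine ⟨⟨hmeas.aestronglyMeasurable, ?_⟩, ?_⟩
  · rw [hasFiniteIntegral_iff_ofReal hnn]
    exact hfinal.trans_lt ENNReal.ofReal_lt_top
  · rw [integral_eq_lintegral_of_nonneg_ae hnn hmeas.aestronglyMeasurable]
    exact ENNReal.toReal_le_of_le_ofReal hC0.le hfinal
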